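/- Let $m$ be Lebesgue measure on $[0,1]$ and let $BS$ be the space of finite signed Borel measures on $[0,1]$. Write $\|\mu\|_1$ for the total variation norm (the $L^1$ norm of the density, if there is one), $\|\mu\|_W=\sup\{\int g\,d\mu:\ |g|\le 1,\ \mathrm{Lip}(g)\le 1\}$, and $\|\mu\|_{BV}=\|\mu\|_1+\mathrm{Var}(d\mu/dm)$. Let $V$ be the space of measures in $BS$ that have an integrable density and total mass $0$, and $V_W=\{\mu\in BS:\mu([0,1])=0\}$. For a Borel map $T:[0,1]\to[0,1]$ let $L_T\mu=T_*\mu$. Let $\pi:\mathbb R\to[0,1]$, $\pi(x)=\min_{i\in\mathbb Z}|x-2i|$; for a finite signed measure $\rho$ on $\mathbb R$ and $\mu\in BS$ put $\rho\,\hat*\,\mu=\pi_*(\rho*\mu)$, with $\mu$ extended by zero to $\mathbb R$. For an operator $L$ let $R(1,L)=\sum_{n\ge0}L^n$. Let $T_0:[0,1]\to[0,1]$ be a Borel map such that (i) $T_0$ is nonsingular ($m(A)=0$ implies $m(T_0^{-1}A)=0$) and piecewise $C^2$: $[0,1]$ is a disjoint union of finitely or countably many intervals, on each of which $T_0$ extends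 to a $C^2$ function on the closure; (ii) there is $C\ge 0$ with $\|L_{T_0}f\|_{BV}\le C\|f\|_{BV}$ for every $f\in BV$; (iii) $T_0$ is eventually onto: for each nonempty open interval $J\subseteq[0,1]$ there is $n$ with $T_0^n(J)=[0,1]$. Let $a>0$, $\rho_\xi=(a+\xi)^{-1}1_{[-(a+\xi)/2,(a+\xi)/2]}$ for $\xi\ge0$, and $L_0=\rho_0\,\hat*\,L_{T_0}(\cdot)$. (a) Let $S:[0,1]\to\mathbb R$ be $1$-Lipschitz with $S(0)=S(1)=0$ and with support a finite union of intervals, let $\bar\delta>0$, and suppose that for each $\delta\in[0,\bar\delta)$ the map $D_\delta(x)=x+\delta S(x)$ is a continuous bijection of $[0,1]$. Let $T_\delta=D_\delta\circ T_0$ and $L_\delta=\rho_0\,\hat*\,L_{T_\delta}(\cdot)$. Then for all sufficiently small $\delta\ge0$ the operator $L_\delta$ has exactly one fixed probability measure; the series $R(1,L_0)$ converges on $V$ in $\|\cdot\|_1$ and defines a continuous operator $V\to V$; and whenever $f_\delta$ is a probability measure with $L_\delta f_\delta=f_\delta$ for each $\delta\in[0,\bar\delta)$, the weak derivative $(-L_{T_0}(f_0)S)'$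 is a finite signed measure on $[0,1]$, $\rho_0\,\hat*\,(-L_{T_0}(f_0)S)'\in V$, and $$\lim_{\delta\to0^+}\left\|\frac{f_\delta-f_0}{\delta}-R(1,L_0)\big[\rho_0\,\hat*\,(-L_{T_0}(f_0)S)'\big]\right\|_1=0 .$$ (Here $L_{T_0}(f_0)$ is identified with its density, and the weak derivative is that on $\mathbb R$ of $-L_{T_0}(f_0)S$ extended by zero.) (b) Suppose moreover that $T_0$ is Lipschitz, and let $L_\xi=\rho_\xi\,\hat*\,L_{T_0}(\cdot)$. Then for all sufficiently small $\xi\ge0$ the operator $L_\xi$ has exactly one fixed probability measure; the series $R(1,L_0)$ converges on $V_W$ in $\|\cdot\|_W$ and defines a continuous operator $(V_W,\|\cdot\|_W)\to (V_W,\|\cdot\|_W)$; and whenever $\bar\xi>0$ and $f_\xi$ is a probability measure with $L_\xi f_\xi=f_\xi$ for each $\xi\in[0,\bar\xi)$, one has $\dot\rho\,\hat*\,L_{T_0}(f_0)\in V_W$ and $$\lim_{\xi\to0^+}\left\|\frac{f_\xi-f_0}{\xi}-R(1,L_0)\big[\dot\rho\,\hat*\,L_{T_0}(f_0)\big]\right\|_W=0,\qquad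 \dot\rho=-a^{-2}1_{[-a/2,a/2]}+\frac{1}{2a}\left(\delta_{-a/2}+\delta_{a/2}\right).$$ -/

import Mathlib

open Set Filter Topology MeasureTheory
open scoped unitInterval NNReal ENNReal

noncomputable section

namespace NoisyInterval

/-- `BS[0,1]`: finite signed Borel measures on the unit interval. -/
abbrev BS : Type := SignedMeasure I

/-! ### The reflecting boundary -/

/-- The real number `min_{i ∈ ℤ} |x - 2 i|`. -/
def foldReal (x : ℝ) : ℝ := ⨅ i : ℤ, |x - 2 * (i : ℝ)|

theorem foldReal_le (x : ℝ) (i : ℤ) : foldReal x ≤ |x - 2 * (i : ℝ)| :=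
  ciInf_le ⟨0, by rintro _ ⟨j, rfl⟩; exact abs_nonneg _⟩ i

theorem foldReal_mem (x : ℝ) : foldReal x ∈ I := by
  refine ⟨le_ciInf fun _ => abs_nonneg _, (foldReal_le x (round (x / 2))).trans ?_⟩
  have h := abs_sub_round (x / 2)
  have e : x - 2 * (round (x / 2) : ℝ) = 2 * (x / 2 - (round (x / 2) : ℝ)) := by ring
  rw [e, abs_mul, abs_of_pos (by norm_num : (0 : ℝ) < 2)]
  linarith

/-- The reflecting map `π : ℝ → [0,1]`, `π x = min_{i ∈ ℤ} |x - 2 i|`. -/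
def fold (x : ℝ) : I := ⟨foldReal x, foldReal_mem x⟩

theorem lipschitzWith_fold : LipschitzWith 1 fold := by
  refine LipschitzWith.of_le_add fun x y => ?_
  suffices H : foldReal x - dist x y ≤ foldReal y by
    have : foldReal x ≤ foldReal y + dist x y := by linarith
    exact this
  refine le_ciInf fun i => ?_
  have h1 := foldReal_le x i
  have h2 : |x - 2 * (i : ℝ)| ≤ |y - 2 * (i : ℝ)| + dist x y := by
    rw [Real.dist_eq]
    have := abs_add_le (y - 2 * (i : ℝ)) (x - y)
    have e : y - 2 * (i : ℝ) + (x - y) = x - 2 * (i : ℝ) := by ring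
    rwa [e] at this
  linarith

/-- Convolution of finite signed measures on `ℝ`: the image of the product measure under
addition. -/
def conv (μ ν : SignedMeasure ℝ) : SignedMeasure ℝ :=
  (μ.prod ν (ContinuousLinearMap.lsmul ℝ ℝ)).map (fun p : ℝ × ℝ => p.1 + p.2)

/-- The boundary reflecting convolution of a signed measure `ρ` on `ℝ` (for instance a noise
distribution) with a signed measure `μ` on `[0,1]`: extend `μ` by zero to `ℝ`, convolve, and push
forward by the reflecting map. -/
def reflConv (ρ : SignedMeasure ℝ) (μ : BS) : BS :=
  (conv ρ (μ.map ((↑) : I → ℝ))).map fold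

/-! ### Transfer operators -/

/-- The transfer operator of a (Borel) map of the interval: push-forward of signed measures. -/
def transfer (T : I → I) (μ : BS) : BS := μ.map T

/-- The annealed transfer operator of the system with deterministic part `T` and additive noise of
distribution `ρ`, with reflecting boundary. -/
def noisyTransfer (ρ : SignedMeasure ℝ) (T : I → I) (μ : BS) : BS := reflConv ρ (transfer T μ)

/-- The uniform noise `a⁻¹ 1_{[-a/2, a/2]}`. -/
def uniformNoise (a : ℝ) : SignedMeasure ℝ :=
  (volume : Measure ℝ).withDensityᵥ ((Icc (-(a / 2)) (a / 2)).indicator fun _ => a⁻¹)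

/-- The derivative of the uniform noise with respect to the radius:
`-a⁻² 1_{[-a/2, a/2]} + (2 a)⁻¹ (δ_{-a/2} + δ_{a/2})`. -/
def uniformNoiseDot (a : ℝ) : SignedMeasure ℝ :=
  (volume : Measure ℝ).withDensityᵥ ((Icc (-(a / 2)) (a / 2)).indicator fun _ => -(a ^ 2)⁻¹)
    + (2 * a)⁻¹ • (VectorMeasure.dirac (-(a / 2)) (1 : ℝ) + VectorMeasure.dirac (a / 2) (1 : ℝ))

/-- `μ` is a fixed probability measure of the operator `L`. -/
def IsStationary (L : BS → BS) (μ : BS) : Prop := 0 ≤ μ ∧ μ univ = 1 ∧ L μ = μ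

/-! ### Norms and spaces -/

/-- The total variation norm, which on measures with an integrable density is the `L¹` norm of the
density. -/
def l1Norm (μ : BS) : ℝ := μ.variation.real univ

/-- The Wasserstein-Kantorovich norm: the supremum of `∫ g dμ` over the 1-Lipschitz functions `g`
with `|g| ≤ 1`. -/
def wNorm (μ : BS) : ℝ :=
  sSup {r : ℝ | ∃ g : I → ℝ, LipschitzWith 1 g ∧ (∀ x, |g x| ≤ 1) ∧ r = ∫ᵛ x, g x ∂•μ}

/-- The `BV` norm `‖f‖₁ + Var f` of a measure with density `f`, where the best version of the
density is used; it is `⊤` when the measure has no density of bounded variation. -/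
def bvNorm (μ : BS) : ℝ≥0∞ :=
  ⨅ (f : I → ℝ) (_ : Integrable f volume ∧ μ = (volume : Measure I).withDensityᵥ f),
    (∫⁻ x, ‖f x‖ₑ + eVariationOn f univ)

/-- `V_w` for the Wasserstein norm: the signed measures of total mass zero. -/
def zeroMass : Submodule ℝ BS where
  carrier := {μ | μ univ = 0}
  zero_mem' := by simp
  add_mem' := by
    intro μ ν hμ hν
    simp only [mem_ofPred_eq] at *
    simp [hμ, hν]
  smul_mem' := by
    intro c μ hμ
    simp only [mem_ofPred_eq] at *
    simp [hμ]

/-- `L¹[0,1]` as a space of measures: those with an integrable density. -/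
def withL1Density : Submodule ℝ BS where
  carrier := {μ | ∃ f : I → ℝ, Integrable f volume ∧ μ = (volume : Measure I).withDensityᵥ f}
  zero_mem' := ⟨0, integrable_zero _ _ _, by simp⟩
  add_mem' := by
    rintro μ ν ⟨f, hf, rfl⟩ ⟨g, hg, rfl⟩
    exact ⟨f + g, hf.add hg, (withDensityᵥ_add hf hg).symm⟩
  smul_mem' := by
    rintro c μ ⟨f, hf, rfl⟩
    exact ⟨c • f, hf.smul c, (withDensityᵥ_smul f c).symm⟩

/-- `V`: the measures with an integrable density and total mass zero. -/
def zeroMassL1 : Submodule ℝ BS := withL1Density ⊓ zeroMass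

/-- `R` is the resolvent `R(z, L) = ∑ zⁿ Lⁿ` as a continuous linear operator `V → V`, for the norm
`nrm`: the series converges at every point of `V` in this norm, and `R` is bounded. -/
structure IsResolvent (nrm : BS → ℝ) (V : Submodule ℝ BS) (z : ℝ) (L : BS → BS)
    (R : V →ₗ[ℝ] V) : Prop where
  tendsto : ∀ v : V, Tendsto
    (fun N : ℕ => nrm ((∑ n ∈ Finset.range N, z ^ n • L^[n] (v : BS)) - (R v : BS))) atTop (𝓝 0)
  bounded : ∃ C : ℝ, ∀ v : V, nrm (R v) ≤ C * nrm v

/-- `ν` is the derivative, in the weak sense, of the integrable function `h` on `[0,1]` extended by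
zero to `ℝ`: all `C¹` test functions are allowed, also those that do not vanish at `0` and `1`. -/
def IsWeakDeriv (h : I → ℝ) (ν : BS) : Prop :=
  Integrable h volume ∧
    ∀ φ : ℝ → ℝ, ContDiff ℝ 1 φ → ∫ᵛ x, φ (x : ℝ) ∂•ν = -∫ x : I, deriv φ (x : ℝ) * h x

/-! ### Hypotheses on the map -/

/-- A piecewise `C²` map: `[0,1]` is a disjoint union of countably many (in particular, possibly
finitely many) intervals, and on each of them the map extends to a `C²` function on the closure. -/
def IsPiecewiseC2 (T : I → I) : Prop :=
  ∃ P : Set (Set I), P.Countable ∧ P.PairwiseDisjoint id ∧ ⋃₀ P = univ ∧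
    ∀ J ∈ P, J.OrdConnected ∧ ∃ g : ℝ → ℝ,
      ContDiffOn ℝ 2 g (closure (((↑) : I → ℝ) '' J)) ∧ ∀ x ∈ J, (T x : ℝ) = g x

/-- The transfer operator is continuous from `BV` to `BV`. -/
def TransferBoundedBV (T : I → I) : Prop :=
  ∃ C : ℝ≥0, ∀ μ : BS, bvNorm μ ≠ ⊤ → bvNorm (transfer T μ) ≤ C * bvNorm μ

/-- Some iterate of the map sends a given nonempty open interval onto `[0,1]`. -/
def EventuallyOnto (T : I → I) : Prop :=
  ∀ c d : I, c < d → ∃ n : ℕ, T^[n] '' Ioo c d = univ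

/-- A finite union of intervals. -/
def IsFiniteUnionOfIntervals (A : Set I) : Prop :=
  ∃ F : Set (Set I), F.Finite ∧ (∀ J ∈ F, J.OrdConnected) ∧ A = ⋃₀ F

end NoisyInterval

end

noncomputable section

namespace NoisyInterval

/-! ### Integration of bounded functions against signed measures -/

section Pairing

variable {X Y : Type*} [MeasurableSpace X] [MeasurableSpace Y]

/-! Everything is done by duality. Integrating a noisy image of a measure against `φ` amounts to
integrating `noiseAvg a φ ∘ T`, where `noiseAvg a φ y` averages the unfolded `φ` over a window of
length `a` about `y`. This average makes bounded functions Lipschitz and continuous functions `C¹`.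
On the side of measures, the noise produces densities, which are of bounded variation when the
measure is positive.

Mixing comes from a Doeblin minorization (`exists_isMixing`). Choose a point `z` outside the
countably many forward images of the discontinuities of `T`. Orbits that end at `z` then pass only
through continuity points, so positivity near `z` propagates backwards along them. Such orbits start
in every interval because `T` is eventually onto, and compactness makes time and constant uniform.
Hence some power of the noisy operator contracts total variation on measures of mass zero. This
yields the Neumann series for the resolvent `R` and the unique stationary measure.

The response rests on the identity `(1 - L₀)(f_δ - f₀) = (L_δ - L₀) f_δ`, hence `f_δ - f₀ = R (L_δ -
L₀) f_δ`. As `L_δ - L₀` is of order `δ` in total variation, so is `f_δ - f₀`, and replacing `f_δ` by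
`f₀` on the right costs only order `δ²`. What remains is to differentiate `δ ↦ L_δ f₀` at zero in a
norm for which `R` is bounded (`tendsto_response`).

When the map is perturbed, `f₀` has bounded variation because it is smoothed by noise, so
`-L_{T₀}(f₀) S` has a measure as weak derivative. The expansion is uniform over continuous test
functions bounded by one, by a change of variables (`tendsto_noisyTransfer_perturb`). When the
radius is perturbed, the derivative involves endpoint values of the test function, so Lipschitz test
functions are used (`abs_noiseAvg_slope_sub_le`). The resolvent is bounded in the Wasserstein norm
because `R v = v + R L v` and, for Lipschitz `T`, `L` maps that norm boundedly into total variation.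
-/

instance isFiniteMeasure_variation (μ : SignedMeasure X) : IsFiniteMeasure μ.variation := by
  rw [← SignedMeasure.totalVariation_eq_variation, SignedMeasure.totalVariation]
  infer_instance

/-- The integral of a function against a signed measure. -/
def pairing (μ : SignedMeasure X) (φ : X → ℝ) : ℝ := ∫ᵛ x, φ x ∂•μ

/-- Bounded measurable real functions. -/
structure IsBddMeas (φ : X → ℝ) : Prop where
  meas : Measurable φ
  bdd : ∃ C, ∀ x, |φ x| ≤ C

theorem IsBddMeas.integrable {φ : X → ℝ} (h : IsBddMeas φ) (m : Measure X) [IsFiniteMeasure m] :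
    Integrable φ m := by
  obtain ⟨C, hC⟩ := h.bdd
  exact Integrable.of_bound h.meas.aestronglyMeasurable C (Eventually.of_forall hC)

theorem IsBddMeas.of_le {φ : X → ℝ} (h : Measurable φ) {C : ℝ} (hC : ∀ x, |φ x| ≤ C) :
    IsBddMeas φ := ⟨h, C, hC⟩

theorem IsBddMeas.const (c : ℝ) : IsBddMeas (fun _ : X => c) := ⟨measurable_const, |c|, fun _ => le_rfl⟩

theorem IsBddMeas.add {φ ψ : X → ℝ} (h : IsBddMeas φ) (h' : IsBddMeas ψ) :
    IsBddMeas (fun x => φ x + ψ x) := by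
  obtain ⟨C, hC⟩ := h.bdd
  obtain ⟨D, hD⟩ := h'.bdd
  exact ⟨h.meas.add h'.meas, C + D, fun x => (abs_add_le _ _).trans (add_le_add (hC x) (hD x))⟩

theorem IsBddMeas.const_mul {φ : X → ℝ} (h : IsBddMeas φ) (c : ℝ) :
    IsBddMeas (fun x => c * φ x) := by
  obtain ⟨C, hC⟩ := h.bdd
  refine ⟨h.meas.const_mul c, |c| * C, fun x => ?_⟩
  rw [abs_mul]
  exact mul_le_mul_of_nonneg_left (hC x) (abs_nonneg c)

theorem IsBddMeas.sub {φ ψ : X → ℝ} (h : IsBddMeas φ) (h' : IsBddMeas ψ) :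
    IsBddMeas (fun x => φ x - ψ x) := by
  have := h.add (h'.const_mul (-1))
  simpa [sub_eq_add_neg] using this

theorem IsBddMeas.comp {φ : X → ℝ} (h : IsBddMeas φ) {f : Y → X} (hf : Measurable f) :
    IsBddMeas (fun y => φ (f y)) := by
  obtain ⟨C, hC⟩ := h.bdd
  exact ⟨h.meas.comp hf, C, fun y => hC _⟩

theorem IsBddMeas.indicator_one {A : Set X} (hA : MeasurableSet A) :
    IsBddMeas (A.indicator fun _ => (1 : ℝ)) := by
  refine ⟨measurable_const.indicator hA, 1, fun x => ?_⟩
  by_cases hx : x ∈ A <;> simp [hx]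

theorem pairing_toSignedMeasure (m : Measure X) [IsFiniteMeasure m] (φ : X → ℝ) :
    pairing m.toSignedMeasure φ = ∫ x, φ x ∂m := by
  rw [← VectorMeasure.integral_toSignedMeasure (μ := m) (f := φ), pairing]
  congr 1
  ext
  simp

theorem pairing_add_left (μ ν : SignedMeasure X) {φ : X → ℝ} (h : IsBddMeas φ) :
    pairing (μ + ν) φ = pairing μ φ + pairing ν φ :=
  VectorMeasure.integral_add_vectorMeasure (h.integrable _) (h.integrable _)

theorem pairing_sub_left (μ ν : SignedMeasure X) {φ : X → ℝ} (h : IsBddMeas φ) :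
    pairing (μ - ν) φ = pairing μ φ - pairing ν φ :=
  VectorMeasure.integral_sub_vectorMeasure (h.integrable _) (h.integrable _)

theorem pairing_smul_left (c : ℝ) (μ : SignedMeasure X) (φ : X → ℝ) :
    pairing (c • μ) φ = c * pairing μ φ :=
  VectorMeasure.integral_smul_vectorMeasure φ c

theorem pairing_sub_right (μ : SignedMeasure X) {φ ψ : X → ℝ} (h : IsBddMeas φ)
    (h' : IsBddMeas ψ) : pairing μ (fun x => φ x - ψ x) = pairing μ φ - pairing μ ψ :=
  VectorMeasure.integral_fun_sub (h.integrable _) (h'.integrable _)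

theorem pairing_const_mul_right (μ : SignedMeasure X) (c : ℝ) (φ : X → ℝ) :
    pairing μ (fun x => c * φ x) = c * pairing μ φ :=
  VectorMeasure.integral_fun_smul μ (ContinuousLinearMap.lsmul ℝ ℝ) c φ

theorem pairing_const (μ : SignedMeasure X) (c : ℝ) : pairing μ (fun _ => c) = c * μ univ := by
  simp [pairing]

theorem pairing_dirac [MeasurableSingletonClass X] (x : X) (c : ℝ) (φ : X → ℝ) :
    pairing (VectorMeasure.dirac x c) φ = c * φ x := by
  rw [pairing, VectorMeasure.integral_dirac]
  simp [mul_comm]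

theorem abs_pairing_le (μ : SignedMeasure X) {φ : X → ℝ} {C : ℝ} (h : ∀ x, |φ x| ≤ C) :
    |pairing μ φ| ≤ C * μ.variation.real univ := by
  have := VectorMeasure.norm_integral_le_of_norm_le_const (μ := μ) (f := φ)
    (B := ContinuousLinearMap.lsmul ℝ ℝ) (C := C) (Eventually.of_forall h)
  rw [← Real.norm_eq_abs]
  refine this.trans ?_
  rcases isEmpty_or_nonempty X with hX | ⟨⟨x⟩⟩
  · simp [VectorMeasure.eq_zero_of_isEmpty]
  have hC : 0 ≤ C := (abs_nonneg _).trans (h x)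
  have h1 : ‖(ContinuousLinearMap.lsmul ℝ ℝ : ℝ →L[ℝ] ℝ →L[ℝ] ℝ)‖ ≤ 1 :=
    ContinuousLinearMap.opNorm_lsmul_le
  gcongr
  nlinarith

theorem pairing_map (μ : SignedMeasure X) {f : X → Y} (hf : Measurable f) {φ : Y → ℝ}
    (h : IsBddMeas φ) : pairing (μ.map f) φ = pairing μ (fun x => φ (f x)) :=
  VectorMeasure.integral_map hf h.meas.aestronglyMeasurable ((h.comp hf).integrable _)

theorem pairing_indicator_one (μ : SignedMeasure X) {A : Set X} (hA : MeasurableSet A) :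
    pairing μ (A.indicator fun _ => (1 : ℝ)) = μ A := by
  rw [pairing, VectorMeasure.integral_indicator hA]
  simp

theorem pairing_restrict (μ : SignedMeasure X) {A : Set X} (hA : MeasurableSet A) (φ : X → ℝ) :
    pairing (μ.restrict A) φ = pairing μ (A.indicator φ) :=
  (VectorMeasure.integral_indicator hA).symm

theorem exists_eq_sub_toSignedMeasure (μ : SignedMeasure X) :
    ∃ (m n : Measure X) (_ : IsFiniteMeasure m) (_ : IsFiniteMeasure n),
      μ = m.toSignedMeasure - n.toSignedMeasure :=
  ⟨_, _, inferInstance, inferInstance, μ.toSignedMeasure_toJordanDecomposition.symm⟩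

theorem exists_toSignedMeasure_of_nonneg {μ : SignedMeasure X} (h : 0 ≤ μ) :
    ∃ (m : Measure X) (_ : IsFiniteMeasure m), μ = m.toSignedMeasure := by
  have h' : 0 ≤[univ] μ := (VectorMeasure.le_restrict_univ_iff_le _ _).2 h
  refine ⟨μ.toMeasureOfZeroLE univ MeasurableSet.univ h', inferInstance, ?_⟩
  exact (SignedMeasure.toMeasureOfZeroLE_toSignedMeasure μ h').symm

theorem pairing_withDensity {m : Measure X} {f φ : X → ℝ} (hf : Integrable f m)
    (h : IsBddMeas φ) : pairing (m.withDensityᵥ f) φ = ∫ x, φ x * f x ∂m := by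
  have := isFiniteMeasure_withDensity_ofReal hf.2
  have := isFiniteMeasure_withDensity_ofReal hf.neg.2
  have e := withDensityᵥ_eq_withDensity_pos_part_sub_withDensity_neg_part hf
  rw [e, pairing_sub_left _ _ h, pairing_toSignedMeasure, pairing_toSignedMeasure]
  obtain ⟨C, hC⟩ := h.bdd
  have key : ∀ g : X → ℝ, Integrable g m →
      ∫ x, φ x ∂(m.withDensity fun x => ENNReal.ofReal (g x)) = ∫ x, φ x * max (g x) 0 ∂m := by
    intro g hg
    rw [integral_withDensity_eq_integral_toReal_smul₀ hg.1.aemeasurable.ennreal_ofReal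
      (Eventually.of_forall fun _ => ENNReal.ofReal_lt_top)]
    refine integral_congr_ae (Eventually.of_forall fun x => ?_)
    simp [ENNReal.toReal_ofReal', mul_comm]
  have hint : ∀ g : X → ℝ, Integrable g m → Integrable (fun x => φ x * max (g x) 0) m := fun g hg =>
    hg.pos_part.bdd_mul h.meas.aestronglyMeasurable (Eventually.of_forall hC)
  have k2 := key _ hf.neg
  simp only [Pi.neg_apply] at k2
  have i2 := hint _ hf.neg
  simp only [Pi.neg_apply] at i2
  rw [key f hf, k2, ← integral_sub (hint f hf) i2]
  refine integral_congr_ae (Eventually.of_forall fun x => ?_)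
  simp only [← mul_sub]
  congr 1
  rcases le_total (f x) 0 with h | h <;> simp [h]

/-- Fubini for signed measures: split both factors into positive and negative parts and identify the
product by its values on rectangles. -/
theorem pairing_prod (ρ : SignedMeasure X) (μ : SignedMeasure Y) {φ : X × Y → ℝ}
    (h : IsBddMeas φ) :
    pairing (ρ.prod μ (ContinuousLinearMap.lsmul ℝ ℝ)) φ =
      pairing μ (fun y => pairing ρ fun x => φ (x, y)) := by
  obtain ⟨m, m', _, _, rfl⟩ := exists_eq_sub_toSignedMeasure ρ
  obtain ⟨n, n', _, _, rfl⟩ := exists_eq_sub_toSignedMeasure μ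
  have e : (m.toSignedMeasure - m'.toSignedMeasure).prod (n.toSignedMeasure - n'.toSignedMeasure)
      (ContinuousLinearMap.lsmul ℝ ℝ) = ((m.prod n).toSignedMeasure - (m.prod n').toSignedMeasure)
        - ((m'.prod n).toSignedMeasure - (m'.prod n').toSignedMeasure) := by
    refine VectorMeasure.prod_eq_of_forall_apply_prod fun s t hs ht => ?_
    have hst := hs.prod ht
    simp only [_root_.sub_apply, Measure.toSignedMeasure_apply_measurable hs,
      Measure.toSignedMeasure_apply_measurable ht, Measure.toSignedMeasure_apply_measurable hst,
      measureReal_prod_prod, ContinuousLinearMap.lsmul_apply, smul_eq_mul]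
    ring
  have hx : ∀ y, IsBddMeas fun x => φ (x, y) := fun y => h.comp (by fun_prop)
  have hint : ∀ k : Measure X, IsFiniteMeasure k → IsBddMeas fun y => ∫ x, φ (x, y) ∂k := by
    intro k _
    obtain ⟨C, hC⟩ := h.bdd
    refine ⟨?_, C * k.real univ, fun y => ?_⟩
    · exact (StronglyMeasurable.integral_prod_right (f := fun y x => φ (x, y))
        (h.meas.comp measurable_swap).stronglyMeasurable).measurable
    · exact norm_integral_le_of_norm_le_const (μ := k) (f := fun x => φ (x, y))
        (Eventually.of_forall fun x => hC (x, y))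
  have e2 : (fun y => pairing (m.toSignedMeasure - m'.toSignedMeasure) fun x => φ (x, y)) =
      fun y => ∫ x, φ (x, y) ∂m - ∫ x, φ (x, y) ∂m' := by
    funext y
    rw [pairing_sub_left _ _ (hx y), pairing_toSignedMeasure, pairing_toSignedMeasure]
  rw [e, e2, pairing_sub_left _ _ h, pairing_sub_left _ _ h, pairing_sub_left _ _ h,
    pairing_sub_left _ _ ((hint m ‹_›).sub (hint m' ‹_›))]
  simp only [pairing_toSignedMeasure]
  have hI : ∀ (k : Measure X) (l : Measure Y), IsFiniteMeasure k → IsFiniteMeasure l →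
      ∫ z, φ z ∂(k.prod l) = ∫ y, ∫ x, φ (x, y) ∂k ∂l := by
    intro k l _ _
    exact integral_prod_symm _ (h.integrable _)
  rw [hI _ _ ‹_› ‹_›, hI _ _ ‹_› ‹_›, hI _ _ ‹_› ‹_›, hI _ _ ‹_› ‹_›,
    integral_sub ((hint m ‹_›).integrable _) ((hint m' ‹_›).integrable _),
    integral_sub ((hint m ‹_›).integrable _) ((hint m' ‹_›).integrable _)]
  ring

/-- A Hahn decomposition: total variation is attained by a test function with values `±1`. -/
theorem exists_variation_eq_sub (μ : SignedMeasure X) :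
    ∃ P, MeasurableSet P ∧ μ.variation.real univ = μ P - μ Pᶜ := by
  obtain ⟨s, hs, hpos, hneg, hposPart, hnegPart⟩ := μ.toJordanDecomposition_spec
  refine ⟨s, hs, ?_⟩
  rw [← SignedMeasure.totalVariation_eq_variation, SignedMeasure.totalVariation,
    measureReal_add_apply, hposPart, hnegPart,
    SignedMeasure.toMeasureOfZeroLE_real_apply _ hpos hs MeasurableSet.univ,
    SignedMeasure.toMeasureOfLEZero_real_apply _ hneg hs.compl MeasurableSet.univ]
  simp [sub_eq_add_neg]

theorem variation_real_le_of_measurable {μ : SignedMeasure X} {C : ℝ}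
    (h : ∀ φ : X → ℝ, Measurable φ → (∀ x, |φ x| ≤ 1) → pairing μ φ ≤ C) :
    μ.variation.real univ ≤ C := by
  obtain ⟨P, hP, e⟩ := exists_variation_eq_sub μ
  rw [e, ← pairing_indicator_one μ hP, ← pairing_indicator_one μ hP.compl,
    ← pairing_sub_right _ (.indicator_one hP) (.indicator_one hP.compl)]
  refine h _ ((IsBddMeas.indicator_one hP).sub (.indicator_one hP.compl)).meas fun x => ?_
  by_cases hx : x ∈ P <;> simp [hx]

/-- Continuous functions are dense in `L¹(|μ|)`. Restricting to continuous tests matters later: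
their noise averages are `C¹`, hence admissible in the definition of the weak derivative. -/
theorem variation_real_le_of_continuous [TopologicalSpace X] [NormalSpace X] [BorelSpace X]
    {μ : SignedMeasure X} [μ.variation.WeaklyRegular] {C : ℝ}
    (h : ∀ φ : X → ℝ, Continuous φ → (∀ x, |φ x| ≤ 1) → pairing μ φ ≤ C) :
    μ.variation.real univ ≤ C := by
  refine variation_real_le_of_measurable fun φ hφ hb => le_of_forall_pos_le_add fun ε hε => ?_
  have hφ' : IsBddMeas φ := .of_le hφ hb
  obtain ⟨g, hg, hgi⟩ := (hφ'.integrable μ.variation).exists_boundedContinuous_lintegral_sub_le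
    (ε := ENNReal.ofReal ε) (by simpa using hε)
  -- Clamping to `[-1, 1]` restores the sup bound and does not increase the distance to `φ`, which
  -- already takes its values there.
  have hcl : ∀ x, |max (-1) (min 1 (g x))| ≤ 1 := fun x =>
    abs_le.2 ⟨le_max_left _ _, max_le (by norm_num) (min_le_left _ _)⟩
  have hc : Continuous fun x => max (-1) (min 1 (g x)) := by fun_prop
  have h1 := h _ hc hcl
  have hg' : IsBddMeas fun x => max (-1) (min 1 (g x)) := .of_le hc.measurable hcl
  have h2 : ‖pairing μ (fun x => φ x - max (-1) (min 1 (g x)))‖ₑ ≤ ENNReal.ofReal ε := by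
    have := VectorMeasure.enorm_integral_le_lintegral_enorm (μ := μ)
      (f := fun x => φ x - max (-1) (min 1 (g x))) (B := ContinuousLinearMap.lsmul ℝ ℝ)
    refine this.trans ?_
    have hB : ‖(ContinuousLinearMap.lsmul ℝ ℝ : ℝ →L[ℝ] ℝ →L[ℝ] ℝ)‖ₑ ≤ 1 := by
      rw [← ofReal_norm, ← ENNReal.ofReal_one]
      exact ENNReal.ofReal_le_ofReal ContinuousLinearMap.opNorm_lsmul_le
    calc _ ≤ 1 * ∫⁻ x, ‖φ x - max (-1) (min 1 (g x))‖ₑ ∂μ.variation := by gcongr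
      _ ≤ ∫⁻ x, ‖φ x - g x‖ₑ ∂μ.variation := by
        rw [one_mul]
        refine lintegral_mono fun x => ?_
        rw [← ofReal_norm, ← ofReal_norm]
        refine ENNReal.ofReal_le_ofReal ?_
        have := abs_le.1 (hb x)
        rw [Real.norm_eq_abs, Real.norm_eq_abs]
        rcases le_total (g x) 1 with h | h <;> rcases le_total (g x) (-1) with h' | h' <;>
          simp only [min_eq_right, min_eq_left, max_eq_left, max_eq_right, h, h'] <;>
          grind
      _ ≤ _ := hg
  rw [pairing_sub_right _ hφ' hg', ← ofReal_norm, ENNReal.ofReal_le_ofReal_iff hε.le,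
    Real.norm_eq_abs] at h2
  linarith [(abs_le.1 h2).2]

end Pairing

section

/-! ### The norms -/

theorem l1Norm_nonneg (μ : BS) : 0 ≤ l1Norm μ := measureReal_nonneg

theorem l1Norm_le {μ : BS} {C : ℝ}
    (h : ∀ φ : I → ℝ, Measurable φ → (∀ x, |φ x| ≤ 1) → pairing μ φ ≤ C) : l1Norm μ ≤ C :=
  variation_real_le_of_measurable h

theorem l1Norm_le_of_continuous {μ : BS} {C : ℝ}
    (h : ∀ φ : I → ℝ, Continuous φ → (∀ x, |φ x| ≤ 1) → pairing μ φ ≤ C) : l1Norm μ ≤ C :=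
  variation_real_le_of_continuous h

theorem abs_pairing_le_l1Norm (μ : BS) {φ : I → ℝ} {C : ℝ} (h : ∀ x, |φ x| ≤ C) :
    |pairing μ φ| ≤ C * l1Norm μ := abs_pairing_le μ h

theorem pairing_le_l1Norm (μ : BS) {φ : I → ℝ} (h : ∀ x, |φ x| ≤ 1) :
    pairing μ φ ≤ l1Norm μ := by
  simpa using (le_abs_self _).trans (abs_pairing_le_l1Norm μ h)

theorem l1Norm_add_le (μ ν : BS) : l1Norm (μ + ν) ≤ l1Norm μ + l1Norm ν :=
  l1Norm_le fun φ hφ hb => by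
    rw [pairing_add_left _ _ (.of_le hφ hb)]
    exact add_le_add (pairing_le_l1Norm μ hb) (pairing_le_l1Norm ν hb)

theorem l1Norm_smul (c : ℝ) (μ : BS) : l1Norm (c • μ) = |c| * l1Norm μ := by
  simp only [l1Norm, VectorMeasure.variation_smul, measureReal_nnreal_smul_apply]
  simp

theorem l1Norm_neg (μ : BS) : l1Norm (-μ) = l1Norm μ := by
  simp [l1Norm]

theorem l1Norm_sub_le (μ ν : BS) : l1Norm (μ - ν) ≤ l1Norm μ + l1Norm ν := by
  rw [sub_eq_add_neg, ← l1Norm_neg ν]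
  exact l1Norm_add_le _ _

theorem abs_apply_le_l1Norm (μ : BS) (A : Set I) : |μ A| ≤ l1Norm μ :=
  (VectorMeasure.norm_measure_le_variation (μ := μ)).trans
    (measureReal_mono (subset_univ _))

theorem l1Norm_zero : l1Norm 0 = 0 := by simp [l1Norm]

theorem eq_zero_of_l1Norm_le {μ : BS} (h : l1Norm μ ≤ 0) : μ = 0 := by
  ext A hA
  have := (abs_apply_le_l1Norm μ A).trans h
  simpa using abs_nonpos_iff.1 this

/-- A measure of zero mass does not see constants, so only the deviation of `φ` from `c` counts.
This turns a minorization into a contraction. -/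
theorem abs_pairing_le_of_zeroMass {v : BS} (hv : v ∈ zeroMass) {φ : I → ℝ} (hφ : IsBddMeas φ)
    {c C : ℝ} (h : ∀ x, |φ x - c| ≤ C) : |pairing v φ| ≤ C * l1Norm v := by
  have h0 : v univ = 0 := hv
  have := abs_pairing_le_l1Norm v h
  rwa [pairing_sub_right _ hφ (.const c), pairing_const, h0, mul_zero, sub_zero] at this

theorem pairing_nonneg {μ : BS} (h : 0 ≤ μ) {φ : I → ℝ} (hφ : ∀ x, 0 ≤ φ x) :
    0 ≤ pairing μ φ := by
  obtain ⟨m, _, rfl⟩ := exists_toSignedMeasure_of_nonneg h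
  rw [pairing_toSignedMeasure]
  exact integral_nonneg hφ

theorem le_of_pairing_nonneg {μ : BS}
    (h : ∀ φ : I → ℝ, IsBddMeas φ → (∀ x, 0 ≤ φ x) → 0 ≤ pairing μ φ) : 0 ≤ μ := by
  intro A hA
  rw [← pairing_indicator_one μ hA]
  refine h _ (.indicator_one hA) fun x => ?_
  by_cases hx : x ∈ A <;> simp [hx]

theorem l1Norm_of_nonneg {μ : BS} (h : 0 ≤ μ) : l1Norm μ = μ univ := by
  obtain ⟨m, _, rfl⟩ := exists_toSignedMeasure_of_nonneg h
  simp [l1Norm]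

theorem bs_ext_pairing {μ ν : BS} (h : ∀ φ : I → ℝ, IsBddMeas φ → pairing μ φ = pairing ν φ) :
    μ = ν := by
  ext A hA
  rw [← pairing_indicator_one μ hA, ← pairing_indicator_one ν hA, h _ (.indicator_one hA)]

theorem isBddMeas_of_lipschitz {g : I → ℝ} {K : ℝ≥0} (h : LipschitzWith K g) {C : ℝ}
    (hC : ∀ x, |g x| ≤ C) : IsBddMeas g := .of_le h.continuous.measurable hC

theorem wNorm_bddAbove (μ : BS) :
    BddAbove {r : ℝ | ∃ g : I → ℝ, LipschitzWith 1 g ∧ (∀ x, |g x| ≤ 1) ∧ r = ∫ᵛ x, g x ∂•μ} := by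
  refine ⟨l1Norm μ, ?_⟩
  rintro _ ⟨g, _, hb, rfl⟩
  exact pairing_le_l1Norm μ hb

theorem pairing_le_wNorm (μ : BS) {g : I → ℝ} (hg : LipschitzWith 1 g) (hb : ∀ x, |g x| ≤ 1) :
    pairing μ g ≤ wNorm μ := le_csSup (wNorm_bddAbove μ) ⟨g, hg, hb, rfl⟩

theorem wNorm_le {μ : BS} {C : ℝ}
    (h : ∀ g : I → ℝ, LipschitzWith 1 g → (∀ x, |g x| ≤ 1) → pairing μ g ≤ C) : wNorm μ ≤ C := by
  refine csSup_le ⟨_, fun _ => 0, LipschitzWith.const' 0, by simp, rfl⟩ ?_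
  rintro _ ⟨g, hg, hb, rfl⟩
  exact h g hg hb

theorem wNorm_nonneg (μ : BS) : 0 ≤ wNorm μ := by
  have := pairing_le_wNorm μ (LipschitzWith.const' (0 : ℝ)) (by simp)
  simpa [pairing_const] using this

theorem wNorm_le_l1Norm (μ : BS) : wNorm μ ≤ l1Norm μ :=
  wNorm_le fun _ _ hb => pairing_le_l1Norm μ hb

theorem wNorm_add_le (μ ν : BS) : wNorm (μ + ν) ≤ wNorm μ + wNorm ν :=
  wNorm_le fun g hg hb => by
    rw [pairing_add_left _ _ (isBddMeas_of_lipschitz hg hb)]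
    exact add_le_add (pairing_le_wNorm μ hg hb) (pairing_le_wNorm ν hg hb)

theorem pairing_le_mul_wNorm (μ : BS) {g : I → ℝ} {C : ℝ≥0} (hC : 0 < C)
    (hg : LipschitzWith C g) (hb : ∀ x, |g x| ≤ C) : pairing μ g ≤ C * wNorm μ := by
  have hC' : (0 : ℝ) < C := hC
  have h := pairing_le_wNorm μ (g := fun x => (C : ℝ)⁻¹ * g x) ?_ ?_
  · rw [pairing_const_mul_right] at h
    rwa [inv_mul_le_iff₀ hC'] at h
  · refine LipschitzWith.of_dist_le_mul fun x y => ?_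
    have := hg.dist_le_mul x y
    rw [Real.dist_eq] at this ⊢
    rw [← mul_sub, abs_mul, abs_inv, abs_of_pos hC', inv_mul_le_iff₀ hC']
    simpa using this
  · intro x
    rw [abs_mul, abs_inv, abs_of_pos hC', inv_mul_le_iff₀ hC', mul_one]
    exact hb x

/-! ### Series of signed measures -/

/-- Completeness in total variation. The sum is formed set by set; countable additivity is an
interchange of a double series dominated by the values of the variations. -/
theorem exists_hasSum_of_summable_l1Norm {μ : ℕ → BS} (h : Summable fun n => l1Norm (μ n)) :
    ∃ s : BS, ∀ A, HasSum (fun n => μ n A) (s A) := by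
  have hA : ∀ A, Summable fun n => μ n A := fun A =>
    .of_norm_bounded h fun n => abs_apply_le_l1Norm _ _
  refine ⟨⟨fun A => ∑' n, μ n A, by simp, fun A hA' => ?_, fun f hf hd => ?_⟩, fun A => (hA A).hasSum⟩
  · simp [VectorMeasure.not_measurable _ hA']
  · have hi : ∀ n, HasSum (fun i => μ n (f i)) (μ n (⋃ i, f i)) := fun n =>
      (μ n).m_iUnion hf hd
    have hv : ∀ n, Summable (fun i => (μ n).variation.real (f i)) ∧
        ∑' i, (μ n).variation.real (f i) ≤ l1Norm (μ n) := by
      intro n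
      have hne : ∑' i, (μ n).variation (f i) ≠ ⊤ := by
        rw [← measure_iUnion hd hf]
        exact measure_ne_top _ _
      refine ⟨ENNReal.summable_toReal hne, ?_⟩
      have e := ENNReal.tsum_toReal_eq (f := fun i => (μ n).variation (f i))
        (fun i => measure_ne_top _ _)
      simp only [measureReal_def] at *
      rw [← e, ← measure_iUnion hd hf]
      exact measureReal_mono (subset_univ _)
    have hs : Summable fun p : ℕ × ℕ => (μ p.1).variation.real (f p.2) := by
      rw [summable_prod_of_nonneg (fun _ => measureReal_nonneg)]
      exact ⟨fun n => (hv n).1, Summable.of_nonneg_of_le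
        (fun n => tsum_nonneg fun _ => measureReal_nonneg) (fun n => (hv n).2) h⟩
    have hs' : Summable fun p : ℕ × ℕ => μ p.1 (f p.2) :=
      .of_norm_bounded hs fun p => VectorMeasure.norm_measure_le_variation
    have e : ∑' n, μ n (⋃ i, f i) = ∑' i, ∑' n, μ n (f i) := by
      rw [Summable.tsum_comm (f := fun n i => μ n (f i)) hs']
      exact tsum_congr fun n => (hi n).tsum_eq.symm
    change HasSum (fun i => ∑' n, μ n (f i)) (∑' n, μ n (⋃ i, f i))
    rw [e]
    exact hs'.prod_symm.prod.hasSum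

theorem l1Norm_le_tsum {μ : ℕ → BS} (h : Summable fun n => l1Norm (μ n)) {s : BS}
    (hs : ∀ A, HasSum (fun n => μ n A) (s A)) : l1Norm s ≤ ∑' n, l1Norm (μ n) := by
  obtain ⟨P, hP, e⟩ := exists_variation_eq_sub s
  rw [l1Norm, e]
  refine hasSum_le (fun n => ?_) ((hs P).sub (hs Pᶜ)) h.hasSum
  rw [← pairing_indicator_one _ hP, ← pairing_indicator_one _ hP.compl,
    ← pairing_sub_right _ (.indicator_one hP) (.indicator_one hP.compl)]
  refine pairing_le_l1Norm _ fun x => ?_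
  by_cases hx : x ∈ P <;> simp [hx]

theorem bs_sum_apply {ι : Type*} (t : Finset ι) (μ : ι → BS) (A : Set I) :
    (∑ i ∈ t, μ i) A = ∑ i ∈ t, μ i A := by
  classical
  induction t using Finset.induction_on with
  | empty => simp
  | insert i t hi ih => rw [Finset.sum_insert hi, Finset.sum_insert hi, ← ih]; rfl

theorem tendsto_l1Norm_sum_sub {μ : ℕ → BS} (h : Summable fun n => l1Norm (μ n)) {s : BS}
    (hs : ∀ A, HasSum (fun n => μ n A) (s A)) :
    Tendsto (fun N => l1Norm ((∑ n ∈ Finset.range N, μ n) - s)) atTop (𝓝 0) := by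
  refine squeeze_zero (fun _ => l1Norm_nonneg _) (fun N => ?_)
    (tendsto_sum_nat_add fun n => l1Norm (μ n))
  rw [← l1Norm_neg, neg_sub]
  -- The error is the sum of the tail, so it is bounded by the tail of the norms.
  refine l1Norm_le_tsum (μ := fun n => μ (n + N)) (s := s - ∑ n ∈ Finset.range N, μ n)
    ((summable_nat_add_iff (f := fun n => l1Norm (μ n)) N).2 h) fun A => ?_
  have := (hasSum_nat_add_iff' (f := fun n => μ n A) N).2 (hs A)
  rw [_root_.sub_apply, bs_sum_apply]
  exact this

/-! ### Markov operators -/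

/-- A linear operator on signed measures that preserves positivity and total mass and whose values
have densities. -/
structure IsMarkov (L : BS →ₗ[ℝ] BS) : Prop where
  mass : ∀ μ, L μ univ = μ univ
  nonneg : ∀ μ, 0 ≤ μ → 0 ≤ L μ
  contr : ∀ μ, l1Norm (L μ) ≤ l1Norm μ
  density : ∀ μ, L μ ∈ withL1Density

/-- The `N`-th power of `L` contracts the measures of zero mass by the factor `θ < 1`. -/
structure IsMixing (L : BS →ₗ[ℝ] BS) (N : ℕ) (θ : ℝ) : Prop extends IsMarkov L where
  lt_one : θ < 1
  mixing : ∀ v ∈ zeroMass, l1Norm (L^[N] v) ≤ θ * l1Norm v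

variable {L L' : BS →ₗ[ℝ] BS} {N : ℕ} {θ : ℝ}

theorem IsMarkov.iterate_mem (h : IsMarkov L) {v : BS} (hv : v ∈ zeroMass) (n : ℕ) :
    L^[n] v ∈ zeroMass := by
  induction n with
  | zero => exact hv
  | succ n ih =>
    rw [Function.iterate_succ_apply']
    exact (h.mass _).trans ih

theorem IsMarkov.iterate_contr (h : IsMarkov L) (v : BS) (n : ℕ) :
    l1Norm (L^[n] v) ≤ l1Norm v := by
  induction n with
  | zero => exact le_rfl
  | succ n ih =>
    rw [Function.iterate_succ_apply']
    exact (h.contr _).trans ih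

/-- One replaces `L` by `L'` a factor at a time. Each replacement costs `ε`, since the other factors
are contractions. -/
theorem IsMarkov.iterate_sub_le (h : IsMarkov L) (h' : IsMarkov L') {ε : ℝ}
    (hε : ∀ μ, l1Norm (L' μ - L μ) ≤ ε * l1Norm μ) (v : BS) (n : ℕ) :
    l1Norm (L'^[n] v - L^[n] v) ≤ n * ε * l1Norm v := by
  have hε0 : 0 ≤ ε * l1Norm v := (l1Norm_nonneg _).trans (hε v)
  induction n with
  | zero => simp [l1Norm_zero]
  | succ n ih =>
    rw [Function.iterate_succ_apply', Function.iterate_succ_apply']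
    have e : L' (L'^[n] v) - L (L^[n] v) =
        L' (L'^[n] v - L^[n] v) + (L' (L^[n] v) - L (L^[n] v)) := by rw [map_sub]; abel
    rw [e]
    refine (l1Norm_add_le _ _).trans ?_
    have h1 := (h'.contr (L'^[n] v - L^[n] v)).trans ih
    have h2 := hε (L^[n] v)
    have h3 := h.iterate_contr v n
    push_cast
    -- The sign of `ε` is not assumed; it follows from the hypothesis only when `v` is nonzero.
    rcases (l1Norm_nonneg v).eq_or_lt with h0 | h0
    · have : l1Norm (L^[n] v) = 0 := le_antisymm (by rw [h0]; exact h3) (l1Norm_nonneg _)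
      rw [this] at h2
      nlinarith
    · have : 0 ≤ ε := nonneg_of_mul_nonneg_left hε0 h0
      nlinarith

/-- Mixing is an open condition: with `N` fixed, the contraction factor moves by at most `N * ε`. -/
theorem IsMixing.perturb (h : IsMixing L N θ) (h' : IsMarkov L') {ε : ℝ}
    (hε : ∀ μ, l1Norm (L' μ - L μ) ≤ ε * l1Norm μ) (hlt : θ + N * ε < 1) :
    IsMixing L' N (θ + N * ε) where
  toIsMarkov := h'
  lt_one := hlt
  mixing v hv := by
    have h1 := h.mixing v hv
    have h2 := h.toIsMarkov.iterate_sub_le h' hε v N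
    have := l1Norm_add_le (L'^[N] v - L^[N] v) (L^[N] v)
    rw [sub_add_cancel] at this
    linarith

/-- If `s` is the sum of the first `M` norms, the first `N + M` norms add up to at most `N ‖v‖ + θ
s`, and this dominates `s`; solve for `s`. -/
theorem IsMixing.sum_range_le (h : IsMixing L N θ) {v : BS} (hv : v ∈ zeroMass) (M : ℕ) :
    ∑ n ∈ Finset.range M, l1Norm (L^[n] v) ≤ N / (1 - θ) * l1Norm v := by
  have h1 : 0 < 1 - θ := by linarith [h.lt_one]
  have hmono : ∑ n ∈ Finset.range M, l1Norm (L^[n] v) ≤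
      ∑ n ∈ Finset.range (N + M), l1Norm (L^[n] v) :=
    Finset.sum_le_sum_of_subset_of_nonneg (by simp) fun _ _ _ => l1Norm_nonneg _
  rw [Finset.sum_range_add] at hmono
  have ha : ∑ n ∈ Finset.range N, l1Norm (L^[n] v) ≤ N * l1Norm v := by
    simpa using Finset.sum_le_card_nsmul (Finset.range N) _ (l1Norm v)
      fun n _ => h.iterate_contr v n
  have hb : ∑ n ∈ Finset.range M, l1Norm (L^[N + n] v) ≤
      θ * ∑ n ∈ Finset.range M, l1Norm (L^[n] v) := by
    rw [Finset.mul_sum]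
    refine Finset.sum_le_sum fun n _ => ?_
    rw [Function.iterate_add_apply]
    exact h.mixing _ (h.iterate_mem hv n)
  rw [div_mul_eq_mul_div, le_div_iff₀ h1]
  nlinarith

theorem IsMixing.summable (h : IsMixing L N θ) {v : BS} (hv : v ∈ zeroMass) :
    Summable fun n => l1Norm (L^[n] v) :=
  summable_of_sum_range_le (fun _ => l1Norm_nonneg _) (h.sum_range_le hv)

/-! ### The resolvent as a Neumann series -/

/-- The sum `∑ Lⁿ v`. -/
def resolventFun (h : IsMixing L N θ) (v : zeroMass) : BS :=
  (exists_hasSum_of_summable_l1Norm (h.summable v.2)).choose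

theorem hasSum_resolventFun (h : IsMixing L N θ) (v : zeroMass) (A : Set I) :
    HasSum (fun n => L^[n] (v : BS) A) (resolventFun h v A) :=
  (exists_hasSum_of_summable_l1Norm (h.summable v.2)).choose_spec A

theorem l1Norm_resolventFun_le (h : IsMixing L N θ) (v : zeroMass) :
    l1Norm (resolventFun h v) ≤ N / (1 - θ) * l1Norm (v : BS) :=
  (l1Norm_le_tsum (h.summable v.2) (hasSum_resolventFun h v)).trans
    (Real.tsum_le_of_sum_range_le (fun _ => l1Norm_nonneg _) (h.sum_range_le v.2))

theorem resolventFun_mem (h : IsMixing L N θ) (v : zeroMass) : resolventFun h v ∈ zeroMass := by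
  refine (hasSum_resolventFun h v univ).unique ?_
  have : (fun n => L^[n] (v : BS) univ) = fun _ => 0 := funext fun n => h.iterate_mem v.2 n
  rw [this]
  exact hasSum_zero

/-- The resolvent on the measures of zero mass. -/
def resolvent (h : IsMixing L N θ) : zeroMass →ₗ[ℝ] zeroMass where
  toFun v := ⟨resolventFun h v, resolventFun_mem h v⟩
  map_add' v w := by
    refine Subtype.ext (VectorMeasure.ext fun A _ => ?_)
    refine (hasSum_resolventFun h (v + w) A).unique ?_
    have := (hasSum_resolventFun h v A).add (hasSum_resolventFun h w A)
    have e : (fun n => L^[n] ((v + w : zeroMass) : BS) A) =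
        fun n => L^[n] (v : BS) A + L^[n] (w : BS) A := by
      funext n
      simp only [← Module.End.pow_apply, Submodule.coe_add, map_add]
      rfl
    rw [e]
    exact this
  map_smul' c v := by
    refine Subtype.ext (VectorMeasure.ext fun A _ => ?_)
    refine (hasSum_resolventFun h (c • v) A).unique ?_
    have := (hasSum_resolventFun h v A).mul_left c
    have e : (fun n => L^[n] ((c • v : zeroMass) : BS) A) = fun n => c * L^[n] (v : BS) A := by
      funext n
      simp only [← Module.End.pow_apply, Submodule.coe_smul, map_smul]
      rfl
    rw [e]
    exact this

theorem tendsto_resolvent (h : IsMixing L N θ) (v : zeroMass) :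
    Tendsto (fun M => l1Norm ((∑ n ∈ Finset.range M, L^[n] (v : BS)) - resolvent h v)) atTop
      (𝓝 0) :=
  tendsto_l1Norm_sum_sub (h.summable v.2) (hasSum_resolventFun h v)

theorem l1Norm_resolvent_le (h : IsMixing L N θ) (v : zeroMass) :
    l1Norm (resolvent h v) ≤ N / (1 - θ) * l1Norm (v : BS) := l1Norm_resolventFun_le h v

/-- Radon–Nikodym. Vanishing on null sets, unlike possession of a density, visibly survives setwise
sums. -/
theorem mem_withL1Density_iff (μ : BS) :
    μ ∈ withL1Density ↔ ∀ A, MeasurableSet A → (volume : Measure I) A = 0 → μ A = 0 := by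
  constructor
  · rintro ⟨f, hf, rfl⟩ A hA h0
    rw [withDensityᵥ_apply hf hA, setIntegral_measure_zero _ h0]
  · intro h
    refine ⟨_, SignedMeasure.integrable_rnDeriv _ _,
      (SignedMeasure.withDensityᵥ_rnDeriv_eq μ volume ?_).symm⟩
    refine VectorMeasure.AbsolutelyContinuous.mk fun A hA h0 => h A hA ?_
    rwa [Measure.toENNRealVectorMeasure_apply_measurable hA] at h0

theorem resolvent_mem_withL1Density (h : IsMixing L N θ) (v : zeroMass)
    (hv : (v : BS) ∈ withL1Density) : (resolvent h v : BS) ∈ withL1Density := by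
  rw [mem_withL1Density_iff]
  intro A hA h0
  refine (hasSum_resolventFun h v A).unique ?_
  have : (fun n => L^[n] (v : BS) A) = fun _ => 0 := by
    funext n
    refine (mem_withL1Density_iff _).1 ?_ A hA h0
    cases n with
    | zero => exact hv
    | succ n =>
      rw [Function.iterate_succ_apply']
      exact h.density _
  rw [this]
  exact hasSum_zero

/-- The resolvent on the measures of zero mass with a density. -/
def resolventL1 (h : IsMixing L N θ) : zeroMassL1 →ₗ[ℝ] zeroMassL1 :=
  LinearMap.codRestrict zeroMassL1
    (zeroMass.subtype ∘ₗ resolvent h ∘ₗ Submodule.inclusion inf_le_right)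
    fun v => ⟨resolvent_mem_withL1Density h _ v.2.1, (resolvent h _).2⟩

theorem coe_resolventL1 (h : IsMixing L N θ) (v : zeroMassL1) :
    (resolventL1 h v : BS) = resolvent h ⟨v, v.2.2⟩ := rfl

theorem isResolvent_resolventL1 (h : IsMixing L N θ) :
    IsResolvent l1Norm zeroMassL1 1 L (resolventL1 h) where
  tendsto v := by
    simpa [coe_resolventL1] using tendsto_resolvent h ⟨v, v.2.2⟩
  bounded := ⟨N / (1 - θ), fun v => l1Norm_resolvent_le h ⟨v, v.2.2⟩⟩

/-- The series for `(1 - L) d` telescopes, and the orbit of `d` is summable. -/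
theorem resolvent_sub_map (h : IsMixing L N θ) {d : BS} (hd : d ∈ zeroMass)
    (hd' : d - L d ∈ zeroMass) : (resolvent h ⟨d - L d, hd'⟩ : BS) = d := by
  refine VectorMeasure.ext fun A _ => (hasSum_resolventFun h _ A).unique ?_
  have hs : Summable fun n => L^[n] d A :=
    .of_norm_bounded (h.summable hd) fun n => abs_apply_le_l1Norm _ _
  have e : (fun n => L^[n] (d - L d) A) = fun n => L^[n] d A - L^[n + 1] d A := by
    funext n
    rw [Function.iterate_succ_apply]
    simp only [← Module.End.pow_apply, map_sub]
    rfl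
  simp only [e]
  have := hs.hasSum.sub ((summable_nat_add_iff 1).2 hs).hasSum
  rw [hs.tsum_eq_zero_add] at this
  simpa using this

/-! ### Stationary measures and the abstract response formula -/

theorem map_sub_mem_zeroMass (h : IsMarkov L) (h' : IsMarkov L') (μ : BS) :
    L' μ - L μ ∈ zeroMass := by
  change (L' μ - L μ) univ = 0
  rw [_root_.sub_apply, h.mass, h'.mass, sub_self]

theorem sub_mem_zeroMass {μ ν : BS} (h : μ univ = ν univ) : μ - ν ∈ zeroMass := by
  change (μ - ν) univ = 0
  rw [_root_.sub_apply, h, sub_self]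

theorem sum_range_iterate_map_sub (L : BS →ₗ[ℝ] BS) (m : BS) (M : ℕ) :
    ∑ n ∈ Finset.range M, L^[n] (L m - m) = L^[M] m - m := by
  have e : ∀ n, L^[n] (L m - m) = L^[n + 1] m - L^[n] m := by
    intro n
    rw [Function.iterate_succ_apply]
    simp only [← Module.End.pow_apply, map_sub]
  simp only [e]
  rw [Finset.sum_range_sub fun n => L^[n] m]
  rfl

/-- The difference of two stationary measures is a fixed point of mass zero, which the contraction
forces to vanish. For existence, the orbit of Lebesgue measure converges in total variation, since
its increments `Lⁿ (L m - m)` form a convergent Neumann series. -/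
theorem IsMixing.existsUnique_stationary (h : IsMixing L N θ) :
    ∃! μ : BS, IsStationary L μ := by
  have huniq : ∀ μ ν : BS, IsStationary L μ → IsStationary L ν → μ = ν := by
    intro μ ν hμ hν
    have hd : μ - ν ∈ zeroMass := sub_mem_zeroMass (hμ.2.1.trans hν.2.1.symm)
    have hfix : L^[N] (μ - ν) = μ - ν :=
      Function.iterate_fixed (by rw [map_sub, hμ.2.2, hν.2.2]) N
    have := h.mixing _ hd
    rw [hfix] at this
    have h0 : l1Norm (μ - ν) ≤ 0 := by nlinarith [l1Norm_nonneg (μ - ν), h.lt_one]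
    exact sub_eq_zero.1 (eq_zero_of_l1Norm_le h0)
  let m : BS := (volume : Measure I).toSignedMeasure
  have hm0 : 0 ≤ m := Measure.zero_le_toSignedMeasure _
  have hm1 : m univ = 1 := by simp [m]
  have hv : L m - m ∈ zeroMass := sub_mem_zeroMass (h.mass m)
  let r := resolvent h ⟨L m - m, hv⟩
  let f : BS := m + r
  have hlim : Tendsto (fun M => l1Norm (L^[M] m - f)) atTop (𝓝 0) := by
    have := tendsto_resolvent h ⟨L m - m, hv⟩
    simp only [sum_range_iterate_map_sub] at this
    refine this.congr fun M => ?_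
    congr 1
    simp only [f, r]
    abel
  have hfix : L f = f := by
    have h1 : l1Norm (L f - f) ≤ 0 := by
      refine ge_of_tendsto' (x := atTop)
        (f := fun M => l1Norm (L^[M] m - f) + l1Norm (L^[M + 1] m - f)) ?_ fun M => ?_
      · simpa using hlim.add (hlim.comp (tendsto_add_atTop_nat 1))
      · have e : L f - f = (L^[M + 1] m - f) - L (L^[M] m - f) := by
          rw [Function.iterate_succ_apply', map_sub]; abel
        rw [e]
        refine (l1Norm_sub_le _ _).trans ?_
        linarith [h.contr (L^[M] m - f)]
    exact sub_eq_zero.1 (eq_zero_of_l1Norm_le h1)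
  have hmass : f univ = 1 := by
    change (m + (r : BS)) univ = 1
    rw [_root_.add_apply, hm1, show (r : BS) univ = 0 from r.2, add_zero]
  have hpos : 0 ≤ f := by
    intro A hA
    have hA' : Tendsto (fun M => L^[M] m A) atTop (𝓝 (f A)) := by
      rw [tendsto_iff_norm_sub_tendsto_zero]
      exact squeeze_zero (fun _ => norm_nonneg _)
        (fun M => abs_apply_le_l1Norm (L^[M] m - f) A) hlim
    refine ge_of_tendsto' hA' fun M => ?_
    have hM : ∀ M, 0 ≤ L^[M] m := by
      intro M
      induction M with
      | zero => exact hm0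
      | succ M ih => rw [Function.iterate_succ_apply']; exact h.nonneg _ ih
    exact hM M A hA
  exact ⟨f, ⟨hpos, hmass, hfix⟩, fun ν hν => huniq _ _ hν ⟨hpos, hmass, hfix⟩⟩

/-- Linear response for a mixing Markov operator: the stationary measures of a Lipschitz family of
Markov operators are differentiable as soon as the family is differentiable at the stationary
measure of the unperturbed operator, in a norm for which the resolvent is bounded. -/
theorem tendsto_response (h : IsMixing L N θ) {Lp : ℝ → BS →ₗ[ℝ] BS}
    (hM : ∀ᶠ δ in 𝓝[>] (0 : ℝ), IsMarkov (Lp δ)) {c : ℝ}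
    (hc : ∀ᶠ δ in 𝓝[>] (0 : ℝ), ∀ μ, l1Norm (Lp δ μ - L μ) ≤ c * δ * l1Norm μ)
    {f : ℝ → BS} (hf0 : IsStationary L (f 0))
    (hf : ∀ᶠ δ in 𝓝[>] (0 : ℝ), IsStationary (Lp δ) (f δ))
    {nrm : BS → ℝ} (hnn : ∀ μ, 0 ≤ nrm μ) (hadd : ∀ μ ν, nrm (μ + ν) ≤ nrm μ + nrm ν)
    (hle : ∀ μ, nrm μ ≤ l1Norm μ) {C : ℝ}
    (hR : ∀ v : zeroMass, nrm (resolvent h v) ≤ C * nrm (v : BS)) (w : zeroMass)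
    (hlim : Tendsto (fun δ : ℝ => nrm (δ⁻¹ • (Lp δ (f 0) - L (f 0)) - (w : BS))) (𝓝[>] 0) (𝓝 0)) :
    Tendsto (fun δ : ℝ => nrm (δ⁻¹ • (f δ - f 0) - (resolvent h w : BS))) (𝓝[>] 0) (𝓝 0) := by
  set R := (N : ℝ) / (1 - θ) with hRdef
  have hR0 : 0 ≤ R := div_nonneg (Nat.cast_nonneg N) (by linarith [h.lt_one])
  have hδ0 : Tendsto (fun δ : ℝ => δ) (𝓝[>] 0) (𝓝 0) := tendsto_id.mono_left nhdsWithin_le_nhds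
  have hz : Tendsto (fun δ : ℝ => |C| * (|c| * (R * (|c| * δ)) +
      nrm (δ⁻¹ • (Lp δ (f 0) - L (f 0)) - (w : BS)))) (𝓝[>] 0) (𝓝 0) := by
    have := (((hδ0.const_mul |c|).const_mul R).const_mul |c|).add hlim |>.const_mul |C|
    simpa using this
  refine squeeze_zero' (Eventually.of_forall fun _ => hnn _) ?_ hz
  filter_upwards [hM, hc, hf, self_mem_nhdsWithin] with δ hM hc hf hδ
  have hδ : 0 < δ := hδ
  have hc' : ∀ μ, l1Norm (Lp δ μ - L μ) ≤ |c| * δ * l1Norm μ := fun μ => (hc μ).trans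
    (mul_le_mul_of_nonneg_right (mul_le_mul_of_nonneg_right (le_abs_self c) hδ.le)
      (l1Norm_nonneg μ))
  have hone : l1Norm (f δ) = 1 := (l1Norm_of_nonneg hf.1).trans hf.2.1
  have hd : f δ - f 0 ∈ zeroMass := sub_mem_zeroMass (hf.2.1.trans hf0.2.1.symm)
  have hx : Lp δ (f δ) - L (f δ) ∈ zeroMass := map_sub_mem_zeroMass h.toIsMarkov hM _
  -- The resolvent identity: subtract the two fixed point equations.
  have e : f δ - f 0 - L (f δ - f 0) = Lp δ (f δ) - L (f δ) := by
    rw [map_sub, hf0.2.2, hf.2.2]; abel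
  have hRd : (resolvent h ⟨_, hx⟩ : BS) = f δ - f 0 := by
    have := resolvent_sub_map h hd (e ▸ hx)
    simpa only [e] using this
  -- A first Lipschitz bound on the response, in total variation whatever `nrm` is.
  have hdn : l1Norm (f δ - f 0) ≤ R * (|c| * δ) := by
    have h1 := l1Norm_resolvent_le h ⟨_, hx⟩
    rw [hRd] at h1
    have h2 := hc' (f δ)
    rw [hone, mul_one] at h2
    exact h1.trans (mul_le_mul_of_nonneg_left h2 hR0)
  let x : zeroMass := ⟨_, hx⟩
  have e2 : δ⁻¹ • (f δ - f 0) - (resolvent h w : BS) =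
      (resolvent h (δ⁻¹ • x + (-1 : ℝ) • w) : BS) := by
    rw [map_add, map_smul, map_smul, Submodule.coe_add, Submodule.coe_smul, Submodule.coe_smul,
      hRd, neg_one_smul, sub_eq_add_neg]
  rw [e2]
  refine (hR _).trans ?_
  refine (mul_le_mul_of_nonneg_right (le_abs_self C) (hnn _)).trans
    (mul_le_mul_of_nonneg_left ?_ (abs_nonneg C))
  -- The first summand is of order `δ`, a product of two quantities of order `δ` divided by `δ`; the
  -- second tends to zero by `hlim`.
  have e3 : ((δ⁻¹ • x + (-1 : ℝ) • w : zeroMass) : BS) =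
      δ⁻¹ • (Lp δ (f δ - f 0) - L (f δ - f 0)) + (δ⁻¹ • (Lp δ (f 0) - L (f 0)) - (w : BS)) := by
    rw [Submodule.coe_add, Submodule.coe_smul, Submodule.coe_smul, neg_one_smul]
    simp only [x, map_sub, smul_sub]
    abel
  rw [e3]
  refine (hadd _ _).trans (add_le_add_left ((hle _).trans ?_) _)
  rw [l1Norm_smul, abs_of_pos (inv_pos.2 hδ), inv_mul_le_iff₀ hδ]
  refine (hc' _).trans ?_
  have := mul_le_mul_of_nonneg_left hdn (mul_nonneg (abs_nonneg c) hδ.le)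
  linarith

end

section

/-! ### The folding map -/

theorem fold_add_two_mul (x : ℝ) (i : ℤ) : fold (x + 2 * i) = fold x := by
  refine Subtype.ext ?_
  change foldReal _ = foldReal _
  unfold foldReal
  refine (Equiv.addRight i).symm.iInf_congr fun j => ?_
  simp only [Equiv.addRight_symm, Equiv.coe_addRight]
  congr 1
  push_cast
  ring

theorem fold_neg (x : ℝ) : fold (-x) = fold x := by
  refine Subtype.ext ?_
  change foldReal _ = foldReal _
  unfold foldReal
  refine (Equiv.neg ℤ).iInf_congr fun j => ?_
  rw [← abs_neg]
  simp only [Equiv.neg_apply]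
  congr 1
  push_cast
  ring

theorem fold_coe (x : I) : fold (x : ℝ) = x := by
  refine Subtype.ext (le_antisymm ?_ (le_ciInf fun i => ?_))
  · have := foldReal_le x 0
    rw [Int.cast_zero, mul_zero, sub_zero, abs_of_nonneg x.2.1] at this
    exact this
  · rcases le_or_gt i 0 with h | h
    · have : (i : ℝ) ≤ 0 := by exact_mod_cast h
      exact le_trans (by linarith) (le_abs_self _)
    · have : (1 : ℝ) ≤ i := by exact_mod_cast h
      exact le_trans (by linarith [x.2.2]) (neg_le_abs _)

theorem continuous_fold : Continuous fold := lipschitzWith_fold.continuous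

/-! ### Averages over the noise -/

theorem IsBddMeas.intervalIntegrable {ψ : ℝ → ℝ} (h : IsBddMeas ψ) (s t : ℝ) :
    IntervalIntegrable ψ volume s t :=
  ⟨h.integrable (volume.restrict (Ioc s t)), h.integrable (volume.restrict (Ioc t s))⟩

theorem IsBddMeas.intervalIntegrable_fold {φ : I → ℝ} (h : IsBddMeas φ) (s t : ℝ) :
    IntervalIntegrable (fun u => φ (fold u)) volume s t :=
  (h.comp continuous_fold.measurable).intervalIntegrable s t

theorem IsBddMeas.mul {X : Type*} [MeasurableSpace X] {φ ψ : X → ℝ} (h : IsBddMeas φ)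
    (h' : IsBddMeas ψ) : IsBddMeas (fun x => φ x * ψ x) := by
  obtain ⟨C, hC⟩ := h.bdd
  obtain ⟨D, hD⟩ := h'.bdd
  refine ⟨h.meas.mul h'.meas, C * D, fun x => ?_⟩
  rw [abs_mul]
  exact mul_le_mul (hC x) (hD x) (abs_nonneg _) ((abs_nonneg _).trans (hC x))

/-- The average of `φ` over the noisy positions that can be reached from `y`. -/
def noiseAvg (a : ℝ) (φ : I → ℝ) (y : ℝ) : ℝ :=
  a⁻¹ * ∫ u in (y - a / 2)..(y + a / 2), φ (fold u)

variable {a : ℝ}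

theorem abs_intervalIntegral_fold_le {φ : I → ℝ} {C : ℝ} (hC : ∀ x, |φ x| ≤ C) (s t : ℝ) :
    |∫ u in s..t, φ (fold u)| ≤ C * |t - s| :=
  intervalIntegral.norm_integral_le_of_norm_le_const (f := fun u => φ (fold u)) fun _ _ => hC _

/-- The integrals over the two shifted windows differ by integrals over two end pieces of length `|y
- z|`. This is the regularizing effect of the noise. -/
theorem abs_noiseAvg_sub_le (ha : 0 < a) {φ : I → ℝ} (h : IsBddMeas φ) {C : ℝ}
    (hC : ∀ x, |φ x| ≤ C) (y z : ℝ) :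
    |noiseAvg a φ y - noiseAvg a φ z| ≤ 2 / a * C * |y - z| := by
  have e : noiseAvg a φ y - noiseAvg a φ z = a⁻¹ * ((∫ u in (z + a / 2)..(y + a / 2), φ (fold u)) -
      ∫ u in (z - a / 2)..(y - a / 2), φ (fold u)) := by
    rw [noiseAvg, noiseAvg, ← mul_sub, intervalIntegral.integral_interval_sub_interval_comm] <;>
      try exact h.intervalIntegrable_fold _ _
    rw [intervalIntegral.integral_symm (z - a / 2) (y - a / 2),
      intervalIntegral.integral_symm (z + a / 2) (y + a / 2)]
    ring
  have h1 := abs_intervalIntegral_fold_le hC (z + a / 2) (y + a / 2)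
  have h2 := abs_intervalIntegral_fold_le hC (z - a / 2) (y - a / 2)
  rw [show y + a / 2 - (z + a / 2) = y - z by ring] at h1
  rw [show y - a / 2 - (z - a / 2) = y - z by ring] at h2
  rw [e, abs_mul, abs_inv, abs_of_pos ha]
  calc _ ≤ a⁻¹ * (C * |y - z| + C * |y - z|) := by
        gcongr
        exact (abs_sub _ _).trans (add_le_add h1 h2)
    _ = _ := by ring

theorem abs_noiseAvg_le (ha : 0 < a) {φ : I → ℝ} {C : ℝ} (hC : ∀ x, |φ x| ≤ C) (y : ℝ) :
    |noiseAvg a φ y| ≤ C := by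
  have h1 := abs_intervalIntegral_fold_le hC (y - a / 2) (y + a / 2)
  rw [show y + a / 2 - (y - a / 2) = a by ring, abs_of_pos ha] at h1
  rw [noiseAvg, abs_mul, abs_inv, abs_of_pos ha, inv_mul_le_iff₀ ha]
  linarith

theorem continuous_noiseAvg (ha : 0 < a) {φ : I → ℝ} (h : IsBddMeas φ) :
    Continuous (noiseAvg a φ) := by
  obtain ⟨C, hC⟩ := h.bdd
  have hC0 : 0 ≤ C := (abs_nonneg _).trans (hC 0)
  refine LipschitzWith.continuous (K := ⟨2 / a * C, by positivity⟩)
    (LipschitzWith.of_dist_le_mul fun y z => ?_)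
  exact abs_noiseAvg_sub_le ha h hC y z

theorem IsBddMeas.noiseAvg (ha : 0 < a) {φ : I → ℝ} (h : IsBddMeas φ) :
    IsBddMeas fun y : I => noiseAvg a φ y := by
  obtain ⟨C, hC⟩ := h.bdd
  exact .of_le ((continuous_noiseAvg ha h).comp continuous_subtype_val).measurable
    fun y => abs_noiseAvg_le ha hC y

theorem noiseAvg_mono (ha : 0 < a) {φ ψ : I → ℝ} (h : IsBddMeas φ) (h' : IsBddMeas ψ)
    (hle : ∀ x, φ x ≤ ψ x) (y : ℝ) : noiseAvg a φ y ≤ noiseAvg a ψ y :=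
  mul_le_mul_of_nonneg_left (intervalIntegral.integral_mono_on (by linarith)
    (h.intervalIntegrable_fold _ _) (h'.intervalIntegrable_fold _ _) fun _ _ => hle _)
    (inv_nonneg.2 ha.le)

theorem noiseAvg_const (ha : 0 < a) (c y : ℝ) : noiseAvg a (fun _ => c) y = c := by
  rw [noiseAvg, intervalIntegral.integral_const]
  field_simp
  simp

theorem noiseAvg_add {φ ψ : I → ℝ} (h : IsBddMeas φ) (h' : IsBddMeas ψ) (y : ℝ) :
    noiseAvg a (fun x => φ x + ψ x) y = noiseAvg a φ y + noiseAvg a ψ y := by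
  rw [noiseAvg, intervalIntegral.integral_add (h.intervalIntegrable_fold _ _)
    (h'.intervalIntegrable_fold _ _), mul_add]
  rfl

theorem noiseAvg_const_mul (c : ℝ) (φ : I → ℝ) (y : ℝ) :
    noiseAvg a (fun x => c * φ x) y = c * noiseAvg a φ y := by
  rw [noiseAvg, intervalIntegral.integral_const_mul, noiseAvg]
  ring

theorem pairing_indicator_Icc (s t c : ℝ) (hst : s ≤ t) {ψ : ℝ → ℝ} (h : IsBddMeas ψ) :
    pairing ((volume : Measure ℝ).withDensityᵥ ((Icc s t).indicator fun _ => c)) ψ =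
      c * ∫ u in s..t, ψ u := by
  have hi : Integrable ((Icc s t).indicator fun _ : ℝ => c) volume :=
    (integrable_indicator_iff measurableSet_Icc).2 (by simp)
  rw [pairing_withDensity hi h, intervalIntegral.integral_of_le hst, ← integral_Icc_eq_integral_Ioc,
    ← integral_indicator measurableSet_Icc, ← integral_const_mul]
  refine integral_congr_ae (Eventually.of_forall fun u => ?_)
  by_cases hu : u ∈ Icc s t <;> simp [hu, mul_comm]

theorem pairing_uniformNoise (ha : 0 < a) {ψ : ℝ → ℝ} (h : IsBddMeas ψ) :
    pairing (uniformNoise a) ψ = a⁻¹ * ∫ u in (-(a / 2))..(a / 2), ψ u :=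
  pairing_indicator_Icc _ _ _ (by linarith) h

/-! ### Integrals against transferred measures -/

theorem pairing_reflConv (ρ : SignedMeasure ℝ) (μ : BS) {φ : I → ℝ} (h : IsBddMeas φ) :
    pairing (reflConv ρ μ) φ =
      pairing μ fun y => pairing ρ fun t => φ (fold (t + (y : ℝ))) := by
  have hf := h.comp continuous_fold.measurable
  have ha : IsBddMeas fun p : ℝ × ℝ => φ (fold (p.1 + p.2)) := hf.comp (by fun_prop)
  rw [reflConv, pairing_map _ continuous_fold.measurable h, conv,
    pairing_map _ (by fun_prop) hf, pairing_prod _ _ ha, pairing_map _ measurable_subtype_coe]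
  obtain ⟨C, hC⟩ := h.bdd
  obtain ⟨m, n, _, _, rfl⟩ := exists_eq_sub_toSignedMeasure ρ
  have hk : ∀ k : Measure ℝ, IsFiniteMeasure k →
      Measurable fun y : ℝ => ∫ t, φ (fold (t + y)) ∂k := by
    intro k _
    exact (StronglyMeasurable.integral_prod_right (f := fun y t => φ (fold (t + y)))
        (ha.meas.comp measurable_swap).stronglyMeasurable).measurable
  have hy : ∀ y : ℝ, IsBddMeas fun t : ℝ => φ (fold (t + y)) := fun y => hf.comp (by fun_prop)
  refine .of_le (C := C * (m.toSignedMeasure - n.toSignedMeasure).variation.real univ) ?_ fun y =>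
    abs_pairing_le _ fun t => hC _
  simp only [pairing_sub_left _ _ (hy _), pairing_toSignedMeasure]
  exact (hk m ‹_›).sub (hk n ‹_›)

theorem pairing_reflConv_uniformNoise (ha : 0 < a) (μ : BS) {φ : I → ℝ} (h : IsBddMeas φ) :
    pairing (reflConv (uniformNoise a) μ) φ = pairing μ fun y : I => noiseAvg a φ y := by
  rw [pairing_reflConv _ _ h]
  congr 1
  funext y
  rw [pairing_uniformNoise ha ((h.comp continuous_fold.measurable).comp (by fun_prop)), noiseAvg,
    intervalIntegral.integral_comp_add_right fun u => φ (fold u)]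
  congr 2 <;> ring

theorem pairing_transfer {T : I → I} (hT : Measurable T) (μ : BS) {φ : I → ℝ}
    (h : IsBddMeas φ) : pairing (transfer T μ) φ = pairing μ fun x => φ (T x) :=
  pairing_map μ hT h

theorem pairing_noisyTransfer (ha : 0 < a) {T : I → I} (hT : Measurable T) (μ : BS) {φ : I → ℝ}
    (h : IsBddMeas φ) : pairing (noisyTransfer (uniformNoise a) T μ) φ =
      pairing μ fun x => noiseAvg a φ (T x) := by
  rw [noisyTransfer, pairing_reflConv_uniformNoise ha _ h, pairing_transfer hT _ (h.noiseAvg ha)]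

/-- The transfer operator with uniform noise as a linear map. -/
def noisyLin (ha : 0 < a) {T : I → I} (hT : Measurable T) : BS →ₗ[ℝ] BS where
  toFun := noisyTransfer (uniformNoise a) T
  map_add' μ ν := bs_ext_pairing fun φ h => by
    rw [pairing_add_left _ _ h, pairing_noisyTransfer ha hT _ h, pairing_noisyTransfer ha hT _ h,
      pairing_noisyTransfer ha hT _ h, pairing_add_left _ _ ((h.noiseAvg ha).comp hT)]
  map_smul' c μ := bs_ext_pairing fun φ h => by
    rw [RingHom.id_apply, pairing_smul_left, pairing_noisyTransfer ha hT _ h,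
      pairing_noisyTransfer ha hT _ h, pairing_smul_left]

theorem coe_noisyLin (ha : 0 < a) {T : I → I} (hT : Measurable T) :
    ⇑(noisyLin ha hT) = noisyTransfer (uniformNoise a) T := rfl

theorem reflConv_uniformNoise_sub (ha : 0 < a) (μ ν : BS) :
    reflConv (uniformNoise a) (μ - ν) =
      reflConv (uniformNoise a) μ - reflConv (uniformNoise a) ν :=
  bs_ext_pairing fun φ h => by
    rw [pairing_sub_left _ _ h, pairing_reflConv_uniformNoise ha _ h,
      pairing_reflConv_uniformNoise ha _ h, pairing_reflConv_uniformNoise ha _ h,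
      pairing_sub_left _ _ (h.noiseAvg ha)]

theorem reflConv_uniformNoise_apply_univ (ha : 0 < a) (μ : BS) :
    reflConv (uniformNoise a) μ univ = μ univ := by
  have := pairing_reflConv_uniformNoise ha μ (.const (1 : ℝ))
  simpa only [noiseAvg_const ha, pairing_const, one_mul] using this

/-! ### The density of a measure smoothed by the noise -/

theorem boundedVariationOn_sub_of_monotone {p q : I → ℝ} (hp : Monotone p) (hq : Monotone q) :
    BoundedVariationOn (fun x => p x - q x) univ := by
  have key : ∀ r : I → ℝ, Monotone r → BoundedVariationOn r univ := fun r hr => by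
    refine (hr.monotoneOn univ).boundedVariationOn (C := |r 0| + |r 1|) fun x _ => ?_
    have h1 : r 0 ≤ r x := hr x.2.1
    have h2 : r x ≤ r 1 := hr x.2.2
    rw [abs_le]
    constructor <;> linarith [neg_abs_le (r 0), abs_nonneg (r 0), abs_nonneg (r 1),
      le_abs_self (r 1)]
  refine ne_top_of_le_ne_top (ENNReal.add_ne_top.2 ⟨key p hp, key q hq⟩) (iSup_le ?_)
  rintro ⟨n, u, hu, us⟩
  calc _ ≤ ∑ i ∈ Finset.range n, (edist (p (u (i + 1))) (p (u i)) +
        edist (q (u (i + 1))) (q (u i))) := Finset.sum_le_sum fun i _ => by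
          simp only [edist_dist, Real.dist_eq]
          rw [← ENNReal.ofReal_add (abs_nonneg _) (abs_nonneg _)]
          refine ENNReal.ofReal_le_ofReal ?_
          rw [show p (u (i + 1)) - q (u (i + 1)) - (p (u i) - q (u i)) =
            (p (u (i + 1)) - p (u i)) - (q (u (i + 1)) - q (u i)) by ring]
          exact abs_sub _ _
    _ ≤ _ := by
      rw [Finset.sum_add_distrib]
      exact add_le_add (eVariationOn.sum_le hu us) (eVariationOn.sum_le hu us)

theorem integrable_of_monotone {p : I → ℝ} (hp : Monotone p) : Integrable p volume := by
  refine Integrable.of_bound hp.measurable.aestronglyMeasurable (|p 0| + |p 1|)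
    (Eventually.of_forall fun x => ?_)
  have h1 : p 0 ≤ p x := hp x.2.1
  have h2 : p x ≤ p 1 := hp x.2.2
  rw [Real.norm_eq_abs, abs_le]
  constructor <;> linarith [neg_abs_le (p 0), abs_nonneg (p 0), abs_nonneg (p 1),
      le_abs_self (p 1)]

theorem integral_unitInterval (F : ℝ → ℝ) : ∫ x : I, F x = ∫ u in (0 : ℝ)..1, F u := by
  rw [integral_subtype measurableSet_Icc, integral_Icc_eq_integral_Ioc,
    intervalIntegral.integral_of_le zero_le_one]

/-- A measure smoothed by the noise has a density which is a difference of monotone functions. -/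
theorem exists_density_reflConv (ha : 0 < a) (m : Measure I) [IsFiniteMeasure m] :
    ∃ p q : I → ℝ, Monotone p ∧ Monotone q ∧ reflConv (uniformNoise a) m.toSignedMeasure =
      (volume : Measure I).withDensityᵥ fun x => p x - q x := by
  obtain ⟨M, hM⟩ := exists_nat_ge a
  -- Before folding, the density at `u` is `a⁻¹` times the mass of `[u - a/2, u + a/2]`, that is
  -- `a⁻¹ (A u - B u)` with `A` and `B` monotone.
  let A : ℝ → ℝ := fun u => m.real {y : I | (y : ℝ) ≤ u + a / 2}
  let B : ℝ → ℝ := fun u => m.real {y : I | (y : ℝ) < u - a / 2}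
  have hA : Monotone A := fun u v huv => measureReal_mono fun y hy => by
    simp only [mem_ofPred_eq] at hy ⊢; linarith
  have hB : Monotone B := fun u v huv => measureReal_mono fun y hy => by
    simp only [mem_ofPred_eq] at hy ⊢; linarith
  let s : ℕ → ℝ := fun k => 2 * ((k : ℤ) - M : ℤ)
  let n := 2 * M + 1
  -- Folding sums the density over the preimages `±x + 2i`; as `a ≤ M`, the range `|i| ≤ M`
  -- suffices. The reflection `-x` reverses monotonicity, so `A` and `B` exchange roles between `p`
  -- and `q`.
  refine ⟨fun x => a⁻¹ * ∑ k ∈ Finset.range n, (A (x + s k) - B (-x + s k)),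
    fun x => a⁻¹ * ∑ k ∈ Finset.range n, (B (x + s k) - A (-x + s k)), ?_, ?_, ?_⟩
  · intro x y hxy
    have hxy : (x : ℝ) ≤ y := hxy
    refine mul_le_mul_of_nonneg_left (Finset.sum_le_sum fun k _ => ?_) (inv_nonneg.2 ha.le)
    exact sub_le_sub (hA (by linarith)) (hB (by linarith))
  · intro x y hxy
    have hxy : (x : ℝ) ≤ y := hxy
    refine mul_le_mul_of_nonneg_left (Finset.sum_le_sum fun k _ => ?_) (inv_nonneg.2 ha.le)
    exact sub_le_sub (hB (by linarith)) (hA (by linarith))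
  have hAb : IsBddMeas A := .of_le (C := m.real univ) hA.measurable fun u => by
    rw [abs_of_nonneg measureReal_nonneg]; exact measureReal_mono (subset_univ _)
  have hBb : IsBddMeas B := .of_le (C := m.real univ) hB.measurable fun u => by
    rw [abs_of_nonneg measureReal_nonneg]; exact measureReal_mono (subset_univ _)
  have hint : Integrable (fun x : I => a⁻¹ * ∑ k ∈ Finset.range n, (A (x + s k) - B (-x + s k)) -
      a⁻¹ * ∑ k ∈ Finset.range n, (B (x + s k) - A (-x + s k))) volume := by
    refine Integrable.sub (Integrable.const_mul (integrable_finsetSum _ fun k _ => ?_) _)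
      (Integrable.const_mul (integrable_finsetSum _ fun k _ => ?_) _)
    · exact ((hAb.comp (by fun_prop)).sub (hBb.comp (by fun_prop))).integrable _
    · exact ((hBb.comp (by fun_prop)).sub (hAb.comp (by fun_prop))).integrable _
  refine bs_ext_pairing fun φ h => ?_
  have hf := h.comp continuous_fold.measurable
  let F : ℝ → ℝ := fun u => φ (fold u) * (A u - B u)
  have hF : IsBddMeas F := hf.mul (hAb.sub hBb)
  rw [pairing_reflConv_uniformNoise ha _ h, pairing_toSignedMeasure, pairing_withDensity hint h]
  have hlo : ∀ y : I, Icc ((y : ℝ) - a / 2) (y + a / 2) ⊆ Ioc (-(2 * M + 1 : ℝ)) (2 * M + 1) := by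
    intro y u hu
    have := y.2.1
    have := y.2.2
    exact ⟨by linarith [hu.1], by linarith [hu.2]⟩
  -- The domain of integration is made independent of `y`, ready for Fubini.
  have e1 : ∀ y : I, noiseAvg a φ y = a⁻¹ * ∫ u in Ioc (-(2 * M + 1 : ℝ)) (2 * M + 1),
      φ (fold u) * {p : ℝ × ℝ | p.1 - a / 2 ≤ p.2 ∧ p.2 ≤ p.1 + a / 2}.indicator 1 (u, (y : ℝ)) := by
    intro y
    rw [noiseAvg, intervalIntegral.integral_of_le (by linarith), ← integral_Icc_eq_integral_Ioc,
      ← inter_eq_self_of_subset_right (hlo y), ← setIntegral_indicator measurableSet_Icc]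
    congr 2
    funext u
    by_cases hu : u ∈ Icc ((y : ℝ) - a / 2) (y + a / 2)
    · have : (u, (y : ℝ)) ∈ {p : ℝ × ℝ | p.1 - a / 2 ≤ p.2 ∧ p.2 ≤ p.1 + a / 2} :=
        ⟨by linarith [hu.2], by linarith [hu.1]⟩
      simp only [indicator_of_mem hu, indicator_of_mem this, Pi.one_apply, mul_one]
    · have : (u, (y : ℝ)) ∉ {p : ℝ × ℝ | p.1 - a / 2 ≤ p.2 ∧ p.2 ≤ p.1 + a / 2} := fun h' =>
        hu ⟨by linarith [h'.2], by linarith [h'.1]⟩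
      simp only [indicator_of_notMem hu, indicator_of_notMem this, mul_zero]
  have hset : MeasurableSet {p : ℝ × ℝ | p.1 - a / 2 ≤ p.2 ∧ p.2 ≤ p.1 + a / 2} :=
    measurableSet_setOfPred.2 (.and (measurableSet_setOfPred.1 (measurableSet_le (by fun_prop) (by fun_prop)))
      (measurableSet_setOfPred.1 (measurableSet_le (by fun_prop) (by fun_prop))))
  have e2 : ∀ u : ℝ, ∫ y : I, {p : ℝ × ℝ | p.1 - a / 2 ≤ p.2 ∧ p.2 ≤ p.1 + a / 2}.indicator
      (1 : ℝ × ℝ → ℝ) (u, (y : ℝ)) ∂m = A u - B u := by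
    intro u
    have hd : {y : I | u - a / 2 ≤ (y : ℝ) ∧ (y : ℝ) ≤ u + a / 2} =
        {y : I | (y : ℝ) ≤ u + a / 2} \ {y : I | (y : ℝ) < u - a / 2} := by
      ext y
      simp only [mem_ofPred_eq, Set.mem_sdiff, not_lt]
      exact and_comm
    have hm : MeasurableSet {y : I | (y : ℝ) < u - a / 2} :=
      measurableSet_lt (by fun_prop) (by fun_prop)
    have hm2 : MeasurableSet {y : I | (y : ℝ) ≤ u + a / 2} :=
      measurableSet_le (by fun_prop) (by fun_prop)
    have hsub : {y : I | (y : ℝ) < u - a / 2} ⊆ {y : I | (y : ℝ) ≤ u + a / 2} := fun y hy => by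
      simp only [mem_ofPred_eq] at hy ⊢; linarith
    rw [← measureReal_sdiff hsub hm, ← hd, ← integral_indicator_one (hd ▸ hm2.diff hm)]
    rfl
  have e3 : ∫ y : I, noiseAvg a φ y ∂m = a⁻¹ * ∫ u in (-(2 * M + 1 : ℝ))..(2 * M + 1), F u := by
    simp only [e1]
    have hb : IsBddMeas fun p : I × ℝ => φ (fold p.2) *
        {p : ℝ × ℝ | p.1 - a / 2 ≤ p.2 ∧ p.2 ≤ p.1 + a / 2}.indicator 1 (p.2, (p.1 : ℝ)) :=
      (hf.comp measurable_snd).mul ((IsBddMeas.indicator_one hset).comp (by fun_prop))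
    rw [integral_const_mul, integral_integral_swap (hb.integrable _),
      intervalIntegral.integral_of_le (by linarith [M.cast_nonneg (α := ℝ)])]
    congr 2
    funext u
    rw [integral_const_mul, e2]
  rw [e3]
  -- The line is cut into cells of length two centred at the points `s k`; each consists of two
  -- copies of `[0,1]`, one of them reflected.
  let b : ℕ → ℝ := fun k => 2 * k - (2 * M + 1)
  have hb0 : b 0 = -(2 * M + 1 : ℝ) := by simp [b]
  have hbn : b n = 2 * M + 1 := by simp only [b, n]; push_cast; ring
  have e4 : ∀ k, ∫ u in (b k)..(b (k + 1)), F u =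
      ∫ v in (0 : ℝ)..1, φ (fold v) * ((A (v + s k) - B (v + s k)) + (A (-v + s k) - B (-v + s k))) := by
    intro k
    have hF' : IsBddMeas fun v => F (v + s k) := hF.comp (by fun_prop)
    have hF2 : IsBddMeas fun v => F (-v + s k) := hF.comp (by fun_prop)
    have h1 : ∫ u in (b k)..(b (k + 1)), F u = ∫ v in (-1 : ℝ)..1, F (v + s k) := by
      rw [intervalIntegral.integral_comp_add_right]
      congr 1 <;> simp only [b, s] <;> push_cast <;> ring
    have h2 : ∫ v in (-1 : ℝ)..0, F (v + s k) = ∫ v in (0 : ℝ)..1, F (-v + s k) := by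
      rw [intervalIntegral.integral_comp_neg fun v => F (v + s k), neg_zero]
    rw [h1, ← intervalIntegral.integral_add_adjacent_intervals (b := 0)
      (hF'.intervalIntegrable _ _) (hF'.intervalIntegrable _ _), h2,
      ← intervalIntegral.integral_add (hF2.intervalIntegrable _ _) (hF'.intervalIntegrable _ _)]
    congr 1
    funext v
    simp only [F, s, fold_add_two_mul, fold_neg]
    ring
  rw [← hb0, ← hbn, ← intervalIntegral.sum_integral_adjacent_intervals fun k _ =>
    hF.intervalIntegrable _ _]
  simp only [e4]
  rw [← intervalIntegral.integral_finsetSum, ← intervalIntegral.integral_const_mul,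
    ← integral_unitInterval]
  · refine integral_congr_ae (Eventually.of_forall fun x => ?_)
    simp only [fold_coe]
    rw [← Finset.mul_sum, ← mul_sub, ← Finset.sum_sub_distrib]
    have : ∀ k, A (x + s k) - B (x + s k) + (A (-x + s k) - B (-x + s k)) =
      A (x + s k) - B (-x + s k) - (B (x + s k) - A (-x + s k)) := fun k => by ring
    simp only [this]
    ring
  · intro k _
    refine IsBddMeas.intervalIntegrable (hf.mul ?_) _ _
    exact ((hAb.comp (by fun_prop)).sub (hBb.comp (by fun_prop))).add
      ((hAb.comp (by fun_prop)).sub (hBb.comp (by fun_prop)))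

theorem reflConv_uniformNoise_mem (ha : 0 < a) (μ : BS) :
    reflConv (uniformNoise a) μ ∈ withL1Density := by
  obtain ⟨m, n, _, _, rfl⟩ := exists_eq_sub_toSignedMeasure μ
  rw [reflConv_uniformNoise_sub ha]
  have key : ∀ (k : Measure I) [IsFiniteMeasure k],
      reflConv (uniformNoise a) k.toSignedMeasure ∈ withL1Density := by
    intro k _
    obtain ⟨p, q, hp, hq, e⟩ := exists_density_reflConv ha k
    exact ⟨_, (integrable_of_monotone hp).sub (integrable_of_monotone hq), e⟩
  rw [sub_eq_add_neg, ← neg_one_smul ℝ (reflConv _ n.toSignedMeasure)]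
  exact withL1Density.add_mem (key m) (withL1Density.smul_mem _ (key n))

/-- Differences of monotone functions have bounded variation. This is where the regularity of
stationary measures comes from. -/
theorem bvNorm_reflConv_ne_top (ha : 0 < a) {μ : BS} (hμ : 0 ≤ μ) :
    bvNorm (reflConv (uniformNoise a) μ) ≠ ⊤ := by
  obtain ⟨m, _, rfl⟩ := exists_toSignedMeasure_of_nonneg hμ
  obtain ⟨p, q, hp, hq, e⟩ := exists_density_reflConv ha m
  have hi := (integrable_of_monotone hp).sub (integrable_of_monotone hq)
  refine ne_top_of_le_ne_top ?_ (iInf₂_le _ ⟨hi, e⟩)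
  -- In `bvNorm` the variation stands under the integral sign, which is harmless because the
  -- interval has measure one.
  rw [lintegral_add_right _ measurable_const, lintegral_const, measure_univ, mul_one]
  exact ENNReal.add_ne_top.2 ⟨hi.2.ne, boundedVariationOn_sub_of_monotone hp hq⟩

theorem exists_boundedVariationOn_density {μ : BS} (h : bvNorm μ ≠ ⊤) :
    ∃ f : I → ℝ, Integrable f volume ∧ μ = (volume : Measure I).withDensityᵥ f ∧
      BoundedVariationOn f univ := by
  obtain ⟨f, h⟩ := iInf_lt_iff.1 (lt_top_iff_ne_top.2 h)
  obtain ⟨hf, h⟩ := iInf_lt_iff.1 h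
  rw [lintegral_add_right _ measurable_const, lintegral_const, measure_univ, mul_one] at h
  exact ⟨f, hf.1, hf.2, (ENNReal.add_ne_top.1 h.ne).2⟩

theorem isMarkov_noisyLin (ha : 0 < a) {T : I → I} (hT : Measurable T) :
    IsMarkov (noisyLin ha hT) where
  mass μ := by
    change reflConv (uniformNoise a) (transfer T μ) univ = _
    rw [reflConv_uniformNoise_apply_univ ha, transfer,
      VectorMeasure.map_apply _ hT MeasurableSet.univ, preimage_univ]
  nonneg μ hμ := le_of_pairing_nonneg fun φ h h0 => by
    rw [coe_noisyLin, pairing_noisyTransfer ha hT _ h]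
    refine pairing_nonneg hμ fun x => ?_
    rw [← noiseAvg_const ha 0 (T x)]
    exact noiseAvg_mono ha (.const 0) h h0 _
  contr μ := l1Norm_le fun φ hφ hb => by
    rw [coe_noisyLin, pairing_noisyTransfer ha hT _ (.of_le hφ hb)]
    exact pairing_le_l1Norm μ fun x => abs_noiseAvg_le ha hb _
  density μ := reflConv_uniformNoise_mem ha _

end

section

/-! ### The dual of the noisy transfer operator -/

variable {a : ℝ} {T : I → I}

/-- The dual of the noisy transfer operator, acting on functions. -/
def noisyDual (a : ℝ) (T : I → I) (φ : I → ℝ) (x : I) : ℝ := noiseAvg a φ (T x)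

theorem IsBddMeas.noisyDual (ha : 0 < a) (hT : Measurable T) {φ : I → ℝ} (h : IsBddMeas φ) :
    IsBddMeas (noisyDual a T φ) := (h.noiseAvg ha).comp hT

theorem IsBddMeas.noisyDual_iterate (ha : 0 < a) (hT : Measurable T) {φ : I → ℝ}
    (h : IsBddMeas φ) (n : ℕ) : IsBddMeas ((NoisyInterval.noisyDual a T)^[n] φ) := by
  induction n generalizing φ with
  | zero => exact h
  | succ n ih => exact ih (h.noisyDual ha hT)

theorem noisyDual_iterate_mono (ha : 0 < a) (hT : Measurable T) {φ ψ : I → ℝ} (h : IsBddMeas φ)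
    (h' : IsBddMeas ψ) (hle : ∀ x, φ x ≤ ψ x) (n : ℕ) (x : I) :
    (noisyDual a T)^[n] φ x ≤ (noisyDual a T)^[n] ψ x := by
  induction n generalizing φ ψ with
  | zero => exact hle x
  | succ n ih =>
    exact ih (h.noisyDual ha hT) (h'.noisyDual ha hT) fun y => noiseAvg_mono ha h h' hle _

theorem noisyDual_iterate_const (ha : 0 < a) (c : ℝ) (n : ℕ) :
    (noisyDual a T)^[n] (fun _ => c) = fun _ => c :=
  Function.iterate_fixed (funext fun _ => noiseAvg_const ha _ _) n

theorem noisyDual_iterate_const_mul (c : ℝ) (φ : I → ℝ) (n : ℕ) :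
    (noisyDual a T)^[n] (fun x => c * φ x) = fun x => c * (noisyDual a T)^[n] φ x := by
  induction n generalizing φ with
  | zero => rfl
  | succ n ih =>
    rw [Function.iterate_succ_apply, Function.iterate_succ_apply, ← ih]
    congr 1
    exact funext fun x => noiseAvg_const_mul _ _ _

theorem noisyDual_iterate_add (ha : 0 < a) (hT : Measurable T) {φ ψ : I → ℝ} (h : IsBddMeas φ)
    (h' : IsBddMeas ψ) (n : ℕ) : (noisyDual a T)^[n] (fun x => φ x + ψ x) =
      fun x => (noisyDual a T)^[n] φ x + (noisyDual a T)^[n] ψ x := by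
  induction n generalizing φ ψ with
  | zero => rfl
  | succ n ih =>
    rw [Function.iterate_succ_apply, Function.iterate_succ_apply, Function.iterate_succ_apply,
      ← ih (h.noisyDual ha hT) (h'.noisyDual ha hT)]
    congr 1
    exact funext fun x => noiseAvg_add h h' _

theorem pairing_noisyLin_iterate (ha : 0 < a) (hT : Measurable T) (μ : BS) {φ : I → ℝ}
    (h : IsBddMeas φ) (n : ℕ) :
    pairing ((noisyLin ha hT)^[n] μ) φ = pairing μ ((noisyDual a T)^[n] φ) := by
  induction n generalizing φ with
  | zero => rfl
  | succ n ih =>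
    rw [Function.iterate_succ_apply', coe_noisyLin, pairing_noisyTransfer ha hT _ h,
      ← coe_noisyLin ha hT]
    exact ih (h.noisyDual ha hT)

/-- A Doeblin minorization makes the noisy transfer operator mixing. -/
theorem isMixing_of_minorization (ha : 0 < a) (hT : Measurable T) {N : ℕ} {κ b z : ℝ} (hb : 0 < b)
    (hκ : 0 < κ) (h : ∀ φ : I → ℝ, IsBddMeas φ → (∀ x, 0 ≤ φ x) →
      ∀ x, κ * noiseAvg b φ z ≤ (noisyDual a T)^[N] φ x) :
    IsMixing (noisyLin ha hT) N (1 - κ) where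
  toIsMarkov := isMarkov_noisyLin ha hT
  lt_one := by linarith
  mixing v hv := l1Norm_le fun φ hφ hφ1 => by
    have hφb : IsBddMeas φ := .of_le hφ hφ1
    rw [pairing_noisyLin_iterate ha hT _ hφb]
    refine (le_abs_self _).trans (abs_pairing_le_of_zeroMass hv (hφb.noisyDual_iterate ha hT N)
      (c := κ * noiseAvg b φ z) fun x => ?_)
    -- Minorizing the images of the nonnegative functions `1 + φ` and `1 - φ` confines the image of
    -- `φ` to within `1 - κ` of the constant `κ * noiseAvg b φ z`.
    have h1 := h (fun x => 1 + φ x) ((IsBddMeas.const 1).add hφb)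
      (fun x => by linarith [(abs_le.1 (hφ1 x)).1]) x
    have h2 := h (fun x => 1 + -1 * φ x) ((IsBddMeas.const 1).add (hφb.const_mul _))
      (fun x => by linarith [(abs_le.1 (hφ1 x)).2]) x
    rw [noisyDual_iterate_add ha hT (.const 1) hφb, noiseAvg_add (.const 1) hφb,
      noiseAvg_const hb, noisyDual_iterate_const ha] at h1
    rw [noisyDual_iterate_add ha hT (.const 1) (hφb.const_mul _),
      noiseAvg_add (.const 1) (hφb.const_mul _), noiseAvg_const hb, noisyDual_iterate_const ha,
      noisyDual_iterate_const_mul, noiseAvg_const_mul] at h2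
    rw [abs_le]
    constructor <;> linarith

/-- The window of length `a / 2` about `z` lies inside the window of length `a` about `y`; the
factor 2 is the ratio of the normalizations. -/
theorem noiseAvg_half_le (ha : 0 < a) {φ : I → ℝ} (h : IsBddMeas φ) (h0 : ∀ x, 0 ≤ φ x)
    {y z : ℝ} (hyz : |y - z| ≤ a / 4) : noiseAvg (a / 2) φ z ≤ 2 * noiseAvg a φ y := by
  have := abs_le.1 hyz
  have hle := intervalIntegral.integral_mono_interval (μ := volume) (f := fun u => φ (fold u))
    (c := y - a / 2) (d := y + a / 2) (a := z - a / 2 / 2) (b := z + a / 2 / 2)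
    (by linarith) (by linarith) (by linarith) (Eventually.of_forall fun u => h0 _)
    (h.intervalIntegrable_fold _ _)
  rw [noiseAvg, noiseAvg, inv_div, div_eq_mul_inv, mul_assoc]
  gcongr

theorem noiseAvg_pos {g : I → ℝ} (h : IsBddMeas g) (h0 : ∀ x, 0 ≤ g x) {x : I}
    (hx : ∀ᶠ w in 𝓝 x, 0 < g w) {y : ℝ} (hy : |y - x| < a / 2) : 0 < noiseAvg a g y := by
  have ha : 0 < a := by linarith [abs_nonneg (y - x)]
  have h1 : ∀ᶠ u in 𝓝 (x : ℝ), 0 < g (fold u) := by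
    have := continuous_fold.tendsto (x : ℝ)
    rw [fold_coe] at this
    exact this.eventually hx
  have hy' := abs_lt.1 hy
  have h2 : ∀ᶠ u in 𝓝 (x : ℝ), u ∈ Ioo (y - a / 2) (y + a / 2) :=
    Ioo_mem_nhds (by linarith) (by linarith)
  obtain ⟨ε, hε, hs⟩ := Metric.eventually_nhds_iff_ball.1 (h1.and h2)
  have hin : ∀ u ∈ Icc (x - ε / 2 : ℝ) (x + ε / 2), u ∈ Metric.ball (x : ℝ) ε := fun u hu => by
    rw [Metric.mem_ball, Real.dist_eq, abs_lt]
    constructor <;> linarith [hu.1, hu.2]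
  have hl := (hs _ (hin (x - ε / 2) ⟨le_rfl, by linarith⟩)).2
  have hr := (hs _ (hin (x + ε / 2) ⟨by linarith, le_rfl⟩)).2
  refine mul_pos (inv_pos.2 ha) ?_
  have hpos := intervalIntegral.intervalIntegral_pos_of_pos_on (a := (x : ℝ) - ε / 2)
    (b := x + ε / 2) (h.intervalIntegrable_fold _ _)
    (fun u hu => (hs u (hin u ⟨hu.1.le, hu.2.le⟩)).1) (by linarith)
  refine hpos.trans_le (intervalIntegral.integral_mono_interval hl.1.le (by linarith) hr.2.le
    (Eventually.of_forall fun u => h0 _) (h.intervalIntegrable_fold _ _))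

/-- Positivity propagates backwards along the orbits of `T` on which `T` is continuous. -/
theorem eventually_noisyDual_iterate_pos (ha : 0 < a) (hT : Measurable T) {g : I → ℝ}
    (h : IsBddMeas g) (h0 : ∀ x, 0 ≤ g x) (n : ℕ) {x : I}
    (hc : ∀ k < n, ContinuousAt T (T^[k] x)) (hx : ∀ᶠ w in 𝓝 (T^[n] x), 0 < g w) :
    ∀ᶠ w in 𝓝 x, 0 < (noisyDual a T)^[n] g w := by
  induction n generalizing x with
  | zero => exact hx
  | succ n ih =>
    rw [Function.iterate_succ_apply] at hx
    have h1 := ih (x := T x) (fun k hk => by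
      rw [← Function.iterate_succ_apply]; exact hc (k + 1) (by lia)) hx
    have hcx : ContinuousAt T x := hc 0 (by lia)
    have h2 : ∀ᶠ w in 𝓝 x, T w ∈ Metric.ball (T x) (a / 2) :=
      hcx.eventually (Metric.ball_mem_nhds _ (by linarith))
    filter_upwards [h2] with w hw
    rw [Function.iterate_succ_apply']
    refine noiseAvg_pos (h.noisyDual_iterate ha hT n) (fun z => ?_) h1 ?_
    · have := noisyDual_iterate_mono ha hT (.const 0) h h0 n z
      rwa [noisyDual_iterate_const ha] at this
    · simpa [Subtype.dist_eq, Real.dist_eq] using hw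

/-! ### Mixing -/

/-- A piecewise `C²` map is continuous off a countable set. -/
theorem IsPiecewiseC2.exists_countable (h : IsPiecewiseC2 T) :
    ∃ B : Set I, B.Countable ∧ ∀ x ∉ B, ContinuousAt T x := by
  obtain ⟨P, hP, -, hU, hJ⟩ := h
  -- The exceptional points are the endpoints belonging to their piece, at most two per piece; any
  -- other point has its piece as a neighbourhood.
  refine ⟨⋃ J ∈ P, {x ∈ J | (∀ y ∈ J, x ≤ y) ∨ ∀ y ∈ J, y ≤ x}, hP.biUnion fun J _ => ?_,
    fun x hx => ?_⟩
  · refine Set.Countable.mono (s₂ := {x ∈ J | ∀ y ∈ J, x ≤ y} ∪ {x ∈ J | ∀ y ∈ J, y ≤ x}) ?_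
      (Set.Countable.union ?_ ?_)
    · rintro x ⟨hx, h | h⟩
      exacts [Or.inl ⟨hx, h⟩, Or.inr ⟨hx, h⟩]
    · exact Set.Subsingleton.countable fun x hx y hy => le_antisymm (hx.2 y hy.1) (hy.2 x hx.1)
    · exact Set.Subsingleton.countable fun x hx y hy => le_antisymm (hy.2 x hx.1) (hx.2 y hy.1)
  · have hxU : x ∈ ⋃₀ P := hU ▸ mem_univ x
    obtain ⟨J, hJP, hxJ⟩ := hxU
    have hx' : ¬((∀ y ∈ J, x ≤ y) ∨ ∀ y ∈ J, y ≤ x) := fun h' =>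
      hx (mem_biUnion hJP ⟨hxJ, h'⟩)
    push Not at hx'
    obtain ⟨⟨p, hp, hpx⟩, q, hq, hxq⟩ := hx'
    obtain ⟨hord, g, hg, hTg⟩ := hJ J hJP
    have hnhds : J ∈ 𝓝 x := mem_of_superset (Ioo_mem_nhds hpx hxq) fun y hy =>
      hord.out hp hq ⟨hy.1.le, hy.2.le⟩
    have hc : ContinuousOn (fun y : I => g y) J := (hg.continuousOn.mono subset_closure).comp
      continuous_subtype_val.continuousOn (mapsTo_image _ _)
    refine Topology.IsInducing.subtypeVal.continuousAt_iff.2 ?_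
    exact (hc.continuousAt hnhds).congr ((mem_of_superset hnhds fun y hy => (hTg y hy).symm))

theorem exists_Ioo_subset_ball (y : I) {r : ℝ} (hr : 0 < r) :
    ∃ c d : I, c < d ∧ Ioo c d ⊆ Metric.ball y r := by
  have hsub : ∀ c d : I, (∀ x ∈ Ioo c d, |(x : ℝ) - y| < r) → Ioo c d ⊆ Metric.ball y r :=
    fun c d h x hx => by simpa [Subtype.dist_eq, Real.dist_eq] using h x hx
  rcases lt_or_ge (y : ℝ) 1 with h | h
  · have hm : min 1 (y + r) ∈ I := ⟨le_min zero_le_one (by linarith [y.2.1]), min_le_left _ _⟩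
    refine ⟨y, ⟨_, hm⟩, lt_min h (by linarith), hsub _ _ fun x hx => ?_⟩
    have h1 : (y : ℝ) < x := hx.1
    have h2 : (x : ℝ) < min 1 (y + r) := hx.2
    rw [abs_lt]
    constructor <;> linarith [min_le_right (1 : ℝ) (y + r)]
  · have hm : max 0 (y - r) ∈ I := ⟨le_max_left _ _, max_le zero_le_one (by linarith [y.2.2])⟩
    refine ⟨⟨_, hm⟩, y, show max 0 (y - r) < (y : ℝ) from max_lt (by linarith) (by linarith), hsub _ _ fun x hx => ?_⟩
    have h1 : (x : ℝ) < y := hx.2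
    have h2 : max 0 (y - r) < (x : ℝ) := hx.1
    rw [abs_lt]
    constructor <;> linarith [le_max_right (0 : ℝ) (y - r)]

/-- The noisy transfer operator of an eventually onto piecewise `C²` map is mixing. -/
theorem exists_isMixing (ha : 0 < a) (hT : Measurable T) (hC2 : IsPiecewiseC2 T)
    (honto : EventuallyOnto T) : ∃ N θ, IsMixing (noisyLin ha hT) N θ := by
  obtain ⟨B, hB, hcont⟩ := hC2.exists_countable
  have hsurj : Function.Surjective T := by
    obtain ⟨n, hn⟩ := honto 0 1 (by norm_num)
    rcases n with _ | n
    · have h0 : (0 : I) ∈ T^[0] '' Ioo 0 1 := hn ▸ mem_univ _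
      obtain ⟨x, hx, hx0⟩ := h0
      have hx0 : x = 0 := hx0
      exact absurd hx.1 (hx0 ▸ lt_irrefl _)
    · intro y
      obtain ⟨x, -, hx⟩ : y ∈ T^[n + 1] '' Ioo 0 1 := hn ▸ mem_univ y
      exact ⟨T^[n] x, by rw [← Function.iterate_succ_apply' T]; exact hx⟩
  -- An orbit segment that ends at `z` never meets `B`, whatever its length. Such a `z` exists
  -- because the excluded set is countable.
  obtain ⟨z, hz⟩ : ∃ z, z ∉ ⋃ j : ℕ, T^[j] '' B := by
    by_contra! h
    have hu : (univ : Set I).Countable := (countable_iUnion fun j => hB.image _).mono fun z _ => h z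
    have h0 := hu.measure_zero (volume : Measure I)
    simp at h0
  -- From a point of `U`, one noisy step covers the window of length `a / 2` about `z` with density
  -- bounded below.
  let U : Set I := T ⁻¹' Metric.ball z (a / 4)
  have hU : MeasurableSet U := hT Metric.isOpen_ball.measurableSet
  let g : I → ℝ := U.indicator fun _ => 1
  have hg : IsBddMeas g := .indicator_one hU
  have hg0 : ∀ x, 0 ≤ g x := fun x => indicator_nonneg (fun _ _ => zero_le_one) x
  have hgn : ∀ n x, 0 ≤ (noisyDual a T)^[n] g x := fun n x => by
    have := noisyDual_iterate_mono ha hT (.const 0) hg hg0 n x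
    rwa [noisyDual_iterate_const ha] at this
  -- Positivity is needed for all `m ≥ n`, so that finitely many balls can share one time;
  -- surjectivity of `T` extends orbits to any later time.
  have hlocal : ∀ y : I, ∃ n : ℕ, ∀ m ≥ n, ∀ y' ∈ Metric.ball y (a / 4),
      0 < noiseAvg a ((noisyDual a T)^[m] g) y' := by
    intro y
    obtain ⟨c, d, hcd, hsub⟩ := exists_Ioo_subset_ball y (show 0 < a / 4 by linarith)
    obtain ⟨n, hn⟩ := honto c d hcd
    refine ⟨n, fun m hm y' hy' => ?_⟩
    have hm' : ∃ x ∈ Ioo c d, T^[m + 1] x = z := by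
      have hs : Function.Surjective (T^[m + 1 - n]) := hsurj.iterate _
      obtain ⟨w, hw⟩ := hs z
      obtain ⟨x, hx, hxw⟩ : w ∈ T^[n] '' Ioo c d := hn ▸ mem_univ w
      refine ⟨x, hx, ?_⟩
      rw [show m + 1 = (m + 1 - n) + n by lia, Function.iterate_add_apply, hxw, hw]
    obtain ⟨x, hx, hxz⟩ := hm'
    have hcx : ∀ k ≤ m, ContinuousAt T (T^[k] x) := fun k hk => by
      refine hcont _ fun hkB => hz (mem_iUnion.2 ⟨m + 1 - k, T^[k] x, hkB, ?_⟩)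
      rw [← Function.iterate_add_apply, show m + 1 - k + k = m + 1 by lia, hxz]
    -- Noise moves `y'` to near `x`, which is closer than `a / 4 + a / 4`, and the orbit of `x` then
    -- leads through `U` to `z`.
    refine noiseAvg_pos (hg.noisyDual_iterate ha hT m) (hgn m)
      (eventually_noisyDual_iterate_pos ha hT hg hg0 m (fun k hk => hcx k hk.le) ?_) (x := x) ?_
    · have h1 : ∀ᶠ w in 𝓝 (T^[m] x), T w ∈ Metric.ball z (a / 4) := by
        refine (hcx m le_rfl).eventually ?_
        rw [← Function.iterate_succ_apply' T, hxz]
        exact Metric.ball_mem_nhds _ (by linarith)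
      filter_upwards [h1] with w hw
      have hwU : w ∈ U := hw
      simp [g, hwU]
    · have h1 : |(x : ℝ) - y| < a / 4 := by
        simpa [Subtype.dist_eq, Real.dist_eq] using hsub hx
      have h2 : |(y' : ℝ) - y| < a / 4 := by
        simpa [Subtype.dist_eq, Real.dist_eq] using hy'
      have := abs_sub_le (y' : ℝ) y x
      rw [abs_sub_comm (y : ℝ) x] at this
      linarith
  choose n hn using hlocal
  obtain ⟨t, ht⟩ := CompactSpace.elim_nhds_subcover (fun y : I => Metric.ball y (a / 4))
    fun y => Metric.ball_mem_nhds _ (by linarith)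
  let M := t.sup n
  have hpos : ∀ y : I, 0 < noiseAvg a ((noisyDual a T)^[M] g) y := by
    intro y
    have hy : y ∈ ⋃ x ∈ t, Metric.ball x (a / 4) := ht ▸ mem_univ y
    simp only [mem_iUnion] at hy
    obtain ⟨x, hx, hyx⟩ := hy
    exact hn x M (Finset.le_sup hx) y hyx
  -- The noise average is continuous even though `T` is not, so its positive minimum gives a uniform
  -- lower bound.
  obtain ⟨y₀, -, hy₀⟩ := isCompact_univ.exists_isMinOn (univ_nonempty (α := I))
    ((continuous_noiseAvg ha (hg.noisyDual_iterate ha hT M)).comp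
      continuous_subtype_val).continuousOn
  -- Of the `M + 2` steps, the first spreads the starting point by the noise, `M` lead to `U`, and
  -- the last covers the window about `z`. The 2 in `κ` is the factor in `noiseAvg_half_le`.
  refine ⟨1 + M + 1, _, isMixing_of_minorization ha hT (b := a / 2) (z := z) (by linarith)
    (κ := noiseAvg a ((noisyDual a T)^[M] g) y₀ / 2) (by linarith [hpos y₀])
    fun φ hφ hφ0 x => ?_⟩
  have hν : 0 ≤ noiseAvg (a / 2) φ z := by
    rw [← noiseAvg_const (show 0 < a / 2 by linarith) 0 z]
    exact noiseAvg_mono (by linarith) (.const 0) hφ hφ0 _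
  have h1 : ∀ w, noiseAvg (a / 2) φ z / 2 * g w ≤ noisyDual a T φ w := by
    intro w
    by_cases hw : w ∈ U
    · have hb : |(T w : ℝ) - z| ≤ a / 4 := by
        have : T w ∈ Metric.ball z (a / 4) := hw
        exact le_of_lt (by simpa [Subtype.dist_eq, Real.dist_eq] using this)
      have := noiseAvg_half_le ha hφ hφ0 hb
      simp only [g, indicator_of_mem hw, mul_one, noisyDual]
      linarith
    · simp only [g, indicator_of_notMem hw, mul_zero]
      rw [← noiseAvg_const ha 0 (T w)]
      exact noiseAvg_mono ha (.const 0) hφ hφ0 _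
  have h2 := noisyDual_iterate_mono ha hT (hg.const_mul _) (hφ.noisyDual ha hT) h1 (1 + M) x
  rw [noisyDual_iterate_const_mul, ← Function.iterate_succ_apply] at h2
  refine le_trans ?_ h2
  rw [add_comm 1 M, Function.iterate_succ_apply']
  have h3 : noiseAvg a ((noisyDual a T)^[M] g) y₀ ≤ noiseAvg a ((noisyDual a T)^[M] g) (T x) :=
    hy₀ (mem_univ (T x))
  have h4 := mul_le_mul_of_nonneg_left h3 (show 0 ≤ noiseAvg (a / 2) φ z / 2 by linarith)
  change _ ≤ noiseAvg (a / 2) φ z / 2 * noiseAvg a ((noisyDual a T)^[M] g) (T x)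
  linarith

end

/-! ### Weak derivatives of functions of bounded variation -/

theorem pairing_comm {X Y : Type*} [MeasurableSpace X] [MeasurableSpace Y] (ρ : SignedMeasure X)
    (μ : SignedMeasure Y) {φ : X × Y → ℝ} (h : IsBddMeas φ) :
    pairing μ (fun y => pairing ρ fun x => φ (x, y)) =
      pairing ρ (fun x => pairing μ fun y => φ (x, y)) := by
  have e : μ.prod ρ (ContinuousLinearMap.lsmul ℝ ℝ) =
      (ρ.prod μ (ContinuousLinearMap.lsmul ℝ ℝ)).map Prod.swap := by
    refine VectorMeasure.prod_eq_of_forall_apply_prod fun s t hs ht => ?_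
    rw [VectorMeasure.map_apply _ measurable_swap (hs.prod ht), preimage_swap_prod,
      VectorMeasure.prod_apply]
    simp [mul_comm]
  have hs : IsBddMeas fun p : Y × X => φ p.swap := h.comp measurable_swap
  have h2 := pairing_prod μ ρ hs
  rw [e, pairing_map _ measurable_swap hs] at h2
  exact (pairing_prod ρ μ h).symm.trans h2

theorem isBddMeas_of_continuous {φ : I → ℝ} (h : Continuous φ) : IsBddMeas φ := by
  obtain ⟨C, hC⟩ := isCompact_univ.exists_bound_of_continuousOn h.continuousOn
  exact .of_le h.measurable fun x => hC x (mem_univ x)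

/-- A difference of monotone functions has countably many discontinuities. The Stieltjes measure of
`h` sees only right limits, so this is what ties it back to `h`. -/
theorem ae_rightLim_eq {h : I → ℝ} (hh : BoundedVariationOn h univ) :
    ∀ᵐ x ∂(volume : Measure I), h x = h.rightLim x := by
  obtain ⟨p, q, hp, hq, rfl⟩ := hh.locallyBoundedVariationOn.exists_monotoneOn_sub_monotoneOn
  rw [monotoneOn_univ] at hp hq
  have hc := (hp.countable_not_continuousAt.union hq.countable_not_continuousAt)
  have h0 := hc.measure_zero (volume : Measure I)
  refine measure_mono_null (fun x hx => ?_) h0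
  by_contra hx'
  simp only [mem_union, mem_ofPred_eq, not_or, not_not] at hx'
  exact hx ((hx'.1.sub hx'.2).continuousWithinAt.rightLim_eq).symm

theorem integral_deriv_Ioi (φ : ℝ → ℝ) (hφ : ContDiff ℝ 1 φ) (s : I) :
    ∫ y : I, (Ici s).indicator (fun y : I => deriv φ y) y = φ 1 - φ s := by
  have hc : Continuous (deriv φ) := hφ.continuous_deriv le_rfl
  have e : ∀ y : I, (Ici s).indicator (fun y : I => deriv φ y) y =
      (Ici (s : ℝ)).indicator (deriv φ) y := fun y => by
    by_cases h : s ≤ y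
    · rw [indicator_of_mem (show y ∈ Ici s from h),
        indicator_of_mem (show (y : ℝ) ∈ Ici (s : ℝ) from h)]
    · rw [indicator_of_notMem (show y ∉ Ici s from h),
        indicator_of_notMem (show (y : ℝ) ∉ Ici (s : ℝ) from h)]
  simp only [e]
  rw [integral_subtype measurableSet_Icc, setIntegral_indicator measurableSet_Ici,
    show Icc (0 : ℝ) 1 ∩ Ici (s : ℝ) = Icc (s : ℝ) 1 by
      ext u; simp only [mem_inter_iff, mem_Icc, mem_Ici]
      exact ⟨fun h => ⟨h.2, h.1.2⟩, fun h => ⟨⟨s.2.1.trans h.1, h.2⟩, h.1⟩⟩,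
    integral_Icc_eq_integral_Ioc, ← intervalIntegral.integral_of_le s.2.2]
  exact intervalIntegral.integral_deriv_eq_sub
    (fun x _ => (hφ.differentiable one_ne_zero).differentiableAt) (hc.intervalIntegrable _ _)

theorem exists_isWeakDeriv {h : I → ℝ} (hi : Integrable h volume)
    (hh : BoundedVariationOn h univ) : ∃ ν : BS, IsWeakDeriv h ν := by
  let W : BS := hh.vectorMeasure
  let r : ℝ := h.rightLim 0
  -- Inside, the derivative is the Stieltjes measure `W`; the two atoms are the jumps at `0` and `1`
  -- of the extension by zero.
  refine ⟨W.restrict (Ioi 0) + VectorMeasure.dirac 0 r -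
    VectorMeasure.dirac 1 (r + W (Ioi 0)), hi, fun φ hφ => ?_⟩
  have hc : Continuous (deriv φ) := hφ.continuous_deriv le_rfl
  have hφb : IsBddMeas fun x : I => φ x :=
    isBddMeas_of_continuous (hφ.continuous.comp continuous_subtype_val)
  have hdb : IsBddMeas fun x : I => deriv φ x :=
    isBddMeas_of_continuous (hc.comp continuous_subtype_val)
  change pairing _ (fun x : I => φ x) = _
  rw [pairing_sub_left _ _ hφb, pairing_add_left _ _ hφb, pairing_dirac, pairing_dirac,
    pairing_restrict _ measurableSet_Ioi]
  have hW : ∀ y : I, W (Ioc 0 y) = h.rightLim y - r := fun y =>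
    hh.vectorMeasure_Ioc y.2.1
  have hset : MeasurableSet {p : I × I | 0 < p.1 ∧ p.1 ≤ p.2} :=
    measurableSet_setOfPred.2 (.and
      (measurableSet_setOfPred.1 (measurableSet_lt (by fun_prop) (by fun_prop)))
      (measurableSet_setOfPred.1 (measurableSet_le (by fun_prop) (by fun_prop))))
  -- Integration by parts is Fubini for this kernel on the triangle `0 < x ≤ y`: integrating in `x`
  -- recovers `h` up to a constant, in `y` the increment of `φ`.
  let G : I × I → ℝ := fun p =>
    deriv φ p.2 * {p : I × I | 0 < p.1 ∧ p.1 ≤ p.2}.indicator (fun _ => 1) p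
  have hG : IsBddMeas G := (hdb.comp measurable_snd).mul (.indicator_one hset)
  have e1 : ∀ y, pairing W (fun x => G (x, y)) = deriv φ y * (h.rightLim y - r) := by
    intro y
    rw [← hW, ← pairing_indicator_one W measurableSet_Ioc, ← pairing_const_mul_right]
    rfl
  have e2 : ∀ x, pairing (volume : Measure I).toSignedMeasure (fun y => G (x, y)) =
      (Ioi (0 : I)).indicator (fun x : I => φ 1 - φ x) x := by
    intro x
    rw [pairing_toSignedMeasure]
    by_cases hx : 0 < x
    · rw [indicator_of_mem (show x ∈ Ioi 0 from hx), ← integral_deriv_Ioi φ hφ x]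
      refine integral_congr_ae (Eventually.of_forall fun y => ?_)
      by_cases hy : x ≤ y <;> simp [G, hx, hy]
    · rw [indicator_of_notMem (show x ∉ Ioi 0 from hx)]
      simp [G, hx]
  have e3 := pairing_comm W (volume : Measure I).toSignedMeasure hG
  simp only [e1, e2] at e3
  rw [pairing_toSignedMeasure] at e3
  have e4 : pairing W ((Ioi (0 : I)).indicator fun x : I => φ 1 - φ x) =
      φ 1 * W (Ioi 0) - pairing W ((Ioi (0 : I)).indicator fun x : I => φ x) := by
    rw [← pairing_restrict _ measurableSet_Ioi, ← pairing_restrict _ measurableSet_Ioi,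
      pairing_sub_right _ (.const _) hφb, pairing_const,
      VectorMeasure.restrict_apply _ measurableSet_Ioi MeasurableSet.univ, univ_inter]
  have e5 : ∫ y : I, deriv φ y * h y = (∫ y : I, deriv φ y * (h.rightLim y - r)) +
      r * (φ 1 - φ 0) := by
    have hr : Integrable (fun y : I => deriv φ y * (h.rightLim y - r)) volume := by
      have : Integrable (fun y : I => deriv φ y * (h y - r)) volume := by
        obtain ⟨C, hC⟩ := hdb.bdd
        exact (hi.sub (integrable_const r)).bdd_mul hdb.meas.aestronglyMeasurable
          (Eventually.of_forall hC)
      refine this.congr ?_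
      filter_upwards [ae_rightLim_eq hh] with y hy
      rw [hy]
    have h1 := integral_deriv_Ioi φ hφ 0
    have hI : (Ici (0 : I)) = univ := eq_univ_of_forall fun y => y.2.1
    simp only [hI, indicator_univ] at h1
    change _ = φ 1 - φ 0 at h1
    rw [← h1, ← integral_const_mul, ← integral_add hr ((hdb.integrable _).const_mul r)]
    refine integral_congr_ae ?_
    filter_upwards [ae_rightLim_eq hh] with y hy
    rw [hy]
    ring
  rw [e5, e3, e4]
  change _ + r * φ 0 - (r + W (Ioi 0)) * φ 1 = _
  ring

/-! ### Perturbation of the map -/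

theorem hausdorffMeasure_unitInterval (A : Set I) : μH[1] A = volume A := by
  rw [unitInterval.volume_apply, ← hausdorffMeasure_real,
    isometry_subtype_coe.hausdorffMeasure_image (Or.inl zero_le_one)]

/-- Lebesgue measure is one-dimensional Hausdorff measure, which an expansion bound controls without
differentiating `D`. -/
theorem volume_preimage_le {D : I → I} {K : ℝ≥0} (hD : AntilipschitzWith K D) (A : Set I) :
    volume (D ⁻¹' A) ≤ K * volume A := by
  have := hD.hausdorffMeasure_preimage_le zero_le_one A
  rwa [hausdorffMeasure_unitInterval, hausdorffMeasure_unitInterval, ENNReal.rpow_one] at this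

theorem integral_comp_le {D : I → I} {K : ℝ≥0} (hm : Measurable D) (hD : AntilipschitzWith K D)
    {F : I → ℝ} (h : IsBddMeas F) (h0 : ∀ x, 0 ≤ F x) : ∫ x, F (D x) ≤ K * ∫ x, F x := by
  have hle : (volume : Measure I).map D ≤ (K : ℝ≥0∞) • volume :=
    Measure.le_iff.2 fun A hA => by
      rw [Measure.map_apply hm hA]
      exact volume_preimage_le hD A
  rw [← integral_map hm.aemeasurable h.meas.aestronglyMeasurable]
  refine (integral_mono_measure hle (Eventually.of_forall h0)
    ((h.integrable volume).smul_measure ENNReal.coe_ne_top)).trans_eq ?_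
  rw [integral_smul_measure]
  simp

/-- The image of Lebesgue measure under `D` is at most `K` times Lebesgue measure and has the same
mass, so the one-sided bound applied to `M + F` and `M - F` gives both sides. -/
theorem abs_integral_comp_sub_le {D : I → I} {K : ℝ≥0} (hK : 1 ≤ K) (hm : Measurable D)
    (hD : AntilipschitzWith K D) {F : I → ℝ} {M : ℝ} (h : IsBddMeas F) (hM : ∀ x, |F x| ≤ M) :
    |(∫ x, F (D x)) - ∫ x, F x| ≤ 2 * M * (K - 1) := by
  have hK' : (0 : ℝ) ≤ K - 1 := sub_nonneg.2 (by exact_mod_cast hK)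
  have e1 := integral_comp_le hm hD ((IsBddMeas.const M).add h)
    fun x => by linarith [neg_abs_le (F x), hM x]
  have e2 := integral_comp_le hm hD ((IsBddMeas.const M).sub h)
    fun x => by linarith [le_abs_self (F x), hM x]
  have i1 := h.integrable (volume : Measure I)
  have i2 := (h.comp hm).integrable (volume : Measure I)
  rw [integral_add (integrable_const M) i1, integral_add (integrable_const M) i2] at e1
  rw [integral_sub (integrable_const M) i1, integral_sub (integrable_const M) i2] at e2
  have hF : |∫ x, F x| ≤ M := by
    have := norm_integral_le_of_norm_le_const (μ := (volume : Measure I)) (f := F) (C := M)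
      (Eventually.of_forall hM)
    simpa using this
  simp only [integral_const, probReal_univ, smul_eq_mul, one_mul] at e1 e2
  rw [abs_le] at hF ⊢
  constructor <;> nlinarith

/-- Distances shrink at most by `1 - t`, and `(1 - t) (1 + 2 t) ≥ 1` for `t ≤ 1/2`. -/
theorem antilipschitzWith_perturb {S : I → ℝ} (hS : LipschitzWith 1 S) {D : I → I} {t : ℝ}
    (ht : 0 ≤ t) (ht2 : t ≤ 1 / 2) (hD : ∀ x : I, (D x : ℝ) = x + t * S x) :
    AntilipschitzWith (Real.toNNReal (1 + 2 * t)) D := by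
  refine AntilipschitzWith.of_le_mul_dist fun x y => ?_
  rw [Real.coe_toNNReal _ (by linarith), Subtype.dist_eq, Subtype.dist_eq, hD, hD, Real.dist_eq,
    Real.dist_eq]
  have h1 := hS.dist_le_mul x y
  rw [NNReal.coe_one, one_mul, Subtype.dist_eq, Real.dist_eq, Real.dist_eq] at h1
  have h2 : (1 - t) * |(x : ℝ) - y| ≤ |(x : ℝ) + t * S x - (y + t * S y)| := by
    have h3 := abs_sub_abs_le_abs_sub ((x : ℝ) - y) (-(t * (S x - S y)))
    rw [abs_neg, abs_mul, abs_of_nonneg ht] at h3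
    rw [show (x : ℝ) + t * S x - (y + t * S y) = x - y - -(t * (S x - S y)) by ring]
    nlinarith
  have h4 : 0 ≤ |(x : ℝ) - y| := abs_nonneg _
  nlinarith [mul_nonneg ht h4]

theorem abs_le_one_of_lipschitz {S : I → ℝ} (hS : LipschitzWith 1 S) (h0 : S 0 = 0) (x : I) :
    |S x| ≤ 1 := by
  have := hS.dist_le_mul x 0
  rw [h0, Real.dist_eq, sub_zero, NNReal.coe_one, one_mul, Subtype.dist_eq, Real.dist_eq] at this
  refine this.trans ?_
  simpa [abs_of_nonneg x.2.1] using x.2.2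

/-- The point is uniformity in `ψ`, for which no continuity is available. The displacement is moved
to `G`, approximated in `L¹` by a continuous function; a near measure-preserving change of variables
then removes it. -/
theorem eventually_abs_integral_comp_sub_le {S : I → ℝ} (hS : LipschitzWith 1 S) (h0 : S 0 = 0)
    {G : I → ℝ} (hG : Integrable G volume) {ε : ℝ} (hε : 0 < ε) :
    ∃ t₀ > 0, ∀ t, 0 ≤ t → t ≤ t₀ → ∀ D : I → I, Measurable D →
      (∀ x : I, (D x : ℝ) = x + t * S x) → ∀ ψ : I → ℝ, Measurable ψ → (∀ x, |ψ x| ≤ 1) →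
        |(∫ y, ψ (D y) * G y) - ∫ y, ψ y * G y| ≤ ε := by
  obtain ⟨G', hG'⟩ := hG.exists_boundedContinuous_integral_sub_le (ε := ε / 4) (by positivity)
  obtain ⟨hG', hi'⟩ := hG'
  obtain ⟨η, hη, hu⟩ := Metric.uniformContinuous_iff.1
    (CompactSpace.uniformContinuous_of_continuous G'.continuous) (ε / 4) (by positivity)
  have hb' : ∀ x, |G' x| ≤ ‖G'‖ := fun x => G'.norm_coe_le_norm x
  have hM : 0 ≤ ‖G'‖ := norm_nonneg _
  -- The error has four parts of size `ε / 4`: two from approximating `G`, one from uniform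
  -- continuity of `G'`, and the change of variables, which costs `2 ‖G'‖ * 2 t`.
  refine ⟨min (1 / 2) (min (η / 2) (ε / (16 * (‖G'‖ + 1)))), by positivity,
    fun t ht ht0 D hD hDx ψ hψ hψ1 => ?_⟩
  have t1 : t ≤ 1 / 2 := ht0.trans (min_le_left _ _)
  have t2 : t < η := by
    have := ht0.trans ((min_le_right _ _).trans (min_le_left _ _))
    linarith
  have t3 : t * (16 * (‖G'‖ + 1)) ≤ ε := by
    rw [← le_div_iff₀ (by positivity)]
    exact ht0.trans ((min_le_right _ _).trans (min_le_right _ _))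
  have hψb : IsBddMeas ψ := .of_le hψ hψ1
  have hG'b : IsBddMeas G' := isBddMeas_of_continuous G'.continuous
  have key : ∀ χ : I → ℝ, Measurable χ → (∀ x, |χ x| ≤ 1) →
      |(∫ y, χ y * G y) - ∫ y, χ y * G' y| ≤ ε / 4 := by
    intro χ hχ hχ1
    rw [← integral_sub (hG.bdd_mul hχ.aestronglyMeasurable (Eventually.of_forall hχ1))
      (hi'.bdd_mul hχ.aestronglyMeasurable (Eventually.of_forall hχ1))]
    refine (norm_integral_le_of_norm_le (μ := (volume : Measure I))
      (f := fun y => χ y * G y - χ y * G' y) (hG.sub hi').norm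
      (Eventually.of_forall fun y => ?_)).trans hG'
    rw [← mul_sub, norm_mul]
    exact mul_le_of_le_one_left (norm_nonneg _) (hχ1 y)
  have k1 := key (fun y => ψ (D y)) (hψ.comp hD) fun x => hψ1 _
  have k2 := key _ hψ hψ1
  have k3 : |(∫ y, ψ (D y) * G' y) - ∫ y, ψ (D y) * G' (D y)| ≤ ε / 4 := by
    rw [← integral_sub (((hψb.comp hD).mul hG'b).integrable _)
      (((hψb.mul hG'b).comp hD).integrable _)]
    refine (norm_integral_le_of_norm_le_const (μ := (volume : Measure I)) (C := ε / 4)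
      (f := fun y => ψ (D y) * G' y - ψ (D y) * G' (D y))
      (Eventually.of_forall fun y => ?_)).trans (by simp)
    rw [← mul_sub, norm_mul]
    refine (mul_le_of_le_one_left (norm_nonneg _) (hψ1 _)).trans ?_
    rw [← dist_eq_norm]
    refine (hu ?_).le
    rw [Subtype.dist_eq, hDx, Real.dist_eq, sub_add_cancel_left, abs_neg, abs_mul, abs_of_nonneg ht]
    exact (mul_le_of_le_one_right ht (abs_le_one_of_lipschitz hS h0 y)).trans_lt t2
  have hK : (1 : ℝ≥0) ≤ Real.toNNReal (1 + 2 * t) := by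
    rw [Real.one_le_toNNReal]; linarith
  have k4 := abs_integral_comp_sub_le (M := ‖G'‖) hK hD (antilipschitzWith_perturb hS ht t1 hDx)
    (hψb.mul hG'b) fun x => by
      rw [abs_mul]
      exact (mul_le_of_le_one_left (abs_nonneg _) (hψ1 _)).trans (hb' x)
  rw [Real.coe_toNNReal _ (by linarith)] at k4
  rw [abs_le] at k1 k2 k3 k4 ⊢
  constructor <;> nlinarith

/-! ### First-order expansion of the perturbed operator in total variation -/

theorem hasDerivAt_noiseAvg (a : ℝ) {φ : I → ℝ} (hφ : Continuous φ) (y : ℝ) :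
    HasDerivAt (noiseAvg a φ) (a⁻¹ * (φ (fold (y + a / 2)) - φ (fold (y - a / 2)))) y := by
  have hc : Continuous fun u => φ (fold u) := hφ.comp continuous_fold
  have h : ∀ z, HasDerivAt (fun z => ∫ u in (0 : ℝ)..z, φ (fold u)) (φ (fold z)) z := fun z =>
    hc.integral_hasStrictDerivAt 0 z |>.hasDerivAt
  have e : noiseAvg a φ = fun y => a⁻¹ * ((∫ u in (0 : ℝ)..(y + a / 2), φ (fold u)) -
      ∫ u in (0 : ℝ)..(y - a / 2), φ (fold u)) := by
    funext y
    rw [noiseAvg, intervalIntegral.integral_interval_sub_left] <;>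
      exact hc.intervalIntegrable _ _
  rw [e]
  exact (((h _).comp_add_const y (a / 2)).sub ((h _).comp_sub_const y (a / 2))).const_mul _

theorem contDiff_noiseAvg (a : ℝ) {φ : I → ℝ} (hφ : Continuous φ) :
    ContDiff ℝ 1 (noiseAvg a φ) := by
  have hc : Continuous fun u => φ (fold u) := hφ.comp continuous_fold
  rw [contDiff_one_iff_deriv]
  refine ⟨fun y => (hasDerivAt_noiseAvg a hφ y).differentiableAt, ?_⟩
  rw [funext fun y => (hasDerivAt_noiseAvg a hφ y).deriv]
  exact ((hc.comp (continuous_add_const _)).sub (hc.comp (continuous_id.sub continuous_const))).const_mul _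

/-- The first-order expansion of an integral along the flow of a perturbation of the identity. -/
theorem hasDerivAt_integral_perturb {S h : I → ℝ} (hS : LipschitzWith 1 S) (h0 : S 0 = 0)
    (hh : Integrable h volume) {g g' : ℝ → ℝ} (hg : ∀ y, HasDerivAt g (g' y) y)
    (hc : Continuous g') {M : ℝ} (hM : ∀ y, |g' y| ≤ M) (hgb : IsBddMeas g) (t : ℝ) :
    HasDerivAt (fun t : ℝ => ∫ y : I, g (y + t * S y) * h y)
      (∫ y : I, g' (y + t * S y) * (S y * h y)) t := by
  have hSc : Continuous S := hS.continuous
  have hgc : Continuous g := continuous_iff_continuousAt.2 fun y => (hg y).continuousAt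
  obtain ⟨C, hC⟩ := hgb.bdd
  have hM0 : 0 ≤ M := (abs_nonneg _).trans (hM 0)
  have hm : ∀ (k : ℝ → ℝ), Continuous k → ∀ t : ℝ, AEStronglyMeasurable
      (fun y : I => k (y + t * S y)) volume := fun k hk t =>
    (Continuous.measurable (by fun_prop)).aestronglyMeasurable
  refine (hasDerivAt_integral_of_dominated_loc_of_deriv_le (μ := (volume : Measure I))
    (F := fun t y => g (y + t * S y) * h y) (F' := fun t y => g' (y + t * S y) * (S y * h y))
    (bound := fun y => M * ‖h y‖) (s := univ) univ_mem
    (Eventually.of_forall fun t => (hm g hgc t).mul hh.1) ?_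
    ((hm g' hc t).mul (hSc.measurable.aestronglyMeasurable.mul hh.1))
    (Eventually.of_forall fun y s _ => ?_) (hh.norm.const_mul M)
    (Eventually.of_forall fun y s _ => ?_)).2
  · exact hh.bdd_mul (hm g hgc t) (Eventually.of_forall fun y => hC _)
  · rw [norm_mul, norm_mul]
    refine mul_le_mul (hM _) ?_ (by positivity) hM0
    exact mul_le_of_le_one_left (norm_nonneg _) (abs_le_one_of_lipschitz hS h0 y)
  · have h1 : HasDerivAt (fun s : ℝ => (y : ℝ) + s * S y) (S y) s := by
      simpa using ((hasDerivAt_id s).mul_const (S y)).const_add (y : ℝ)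
    have h2 := ((hg (y + s * S y)).comp s h1).mul_const (h y)
    rwa [mul_assoc] at h2

/-- Tested against continuous `φ`, the perturbed operator becomes `F t = ∫ g (y + t S y) h y` with
`g` the noise average of `φ`. The weak derivative supplies `F' 0`, and the mean value inequality
reduces the claim to `F'` being near `F' 0` on `[0, δ]` uniformly in `φ`. -/
theorem tendsto_noisyTransfer_perturb {a : ℝ} (ha : 0 < a) {T : I → I} (hT : Measurable T)
    {μ : BS} {h : I → ℝ} (hh : Integrable h volume)
    (hμ : transfer T μ = (volume : Measure I).withDensityᵥ h) {S : I → ℝ}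
    (hS : LipschitzWith 1 S) (h0 : S 0 = 0) {D : ℝ → I → I} {r : ℝ} (hr : 0 < r)
    (hD : ∀ δ ∈ Ico 0 r, Measurable (D δ) ∧ ∀ x : I, (D δ x : ℝ) = x + δ * S x) {ν : BS}
    (hν : IsWeakDeriv (fun x => -(h x * S x)) ν) :
    Tendsto (fun δ : ℝ => l1Norm (δ⁻¹ • (noisyTransfer (uniformNoise a) (D δ ∘ T) μ -
      noisyTransfer (uniformNoise a) T μ) - reflConv (uniformNoise a) ν)) (𝓝[>] 0) (𝓝 0) := by
  have hSb : IsBddMeas S := .of_le hS.continuous.measurable (abs_le_one_of_lipschitz hS h0)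
  have hSh : Integrable (fun y => S y * h y) volume :=
    hh.bdd_mul hSb.meas.aestronglyMeasurable
      (Eventually.of_forall (abs_le_one_of_lipschitz hS h0))
  rw [Metric.tendsto_nhds]
  intro ε hε
  -- Since `|g'| ≤ 2 / a`, the admissible test function is `(a / 2) g'`; dividing by `a / 2` turns
  -- `a ε / 4` into `ε / 2`.
  obtain ⟨t₀, ht₀, hC⟩ := eventually_abs_integral_comp_sub_le hS h0 hSh
    (show 0 < a * ε / 4 by positivity)
  filter_upwards [Ioo_mem_nhdsGT (lt_min ht₀ hr)] with δ hδ
  have hδr : δ < r := hδ.2.trans_le (min_le_right _ _)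
  have hδt : δ < t₀ := hδ.2.trans_le (min_le_left _ _)
  rw [Real.dist_eq, sub_zero, abs_of_nonneg (l1Norm_nonneg _)]
  refine (l1Norm_le_of_continuous (C := ε / 2) fun φ hφ hφ1 => ?_).trans_lt (by linarith)
  have hφb : IsBddMeas φ := .of_le hφ.measurable hφ1
  have hfc : Continuous fun u => φ (fold u) := hφ.comp continuous_fold
  have hgb : IsBddMeas (noiseAvg a φ) :=
    .of_le (continuous_noiseAvg ha hφb).measurable fun y => abs_noiseAvg_le ha hφ1 y
  have hgbI := hφb.noiseAvg ha
  let g' : ℝ → ℝ := fun y => a⁻¹ * (φ (fold (y + a / 2)) - φ (fold (y - a / 2)))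
  have hg' : ∀ y, HasDerivAt (noiseAvg a φ) (g' y) y := hasDerivAt_noiseAvg a hφ
  have hg'c : Continuous g' :=
    ((hfc.comp (continuous_add_const _)).sub
      (hfc.comp (continuous_id.sub continuous_const))).const_mul _
  have hg'1 : ∀ y, |a / 2 * g' y| ≤ 1 := fun y => by
    have e : a / 2 * g' y = (φ (fold (y + a / 2)) - φ (fold (y - a / 2))) / 2 := by
      simp only [g']; field_simp
    rw [e, abs_le]
    have h1 := abs_le.1 (hφ1 (fold (y + a / 2)))
    have h2 := abs_le.1 (hφ1 (fold (y - a / 2)))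
    constructor <;> linarith
  have hg'b : ∀ y, |g' y| ≤ 2 / a := fun y => by
    have := hg'1 y
    rw [abs_mul, abs_of_pos (by positivity : 0 < a / 2)] at this
    rw [le_div_iff₀ ha]
    linarith
  let c : ℝ := ∫ y : I, g' y * (S y * h y)
  let F : ℝ → ℝ := fun t => ∫ y : I, noiseAvg a φ (y + t * S y) * h y
  have hF : ∀ t, HasDerivAt (fun t => F t - t * c)
      ((∫ y : I, g' (y + t * S y) * (S y * h y)) - c) t := fun t => by
    have := (hasDerivAt_integral_perturb hS h0 hh hg' hg'c hg'b hgb t).sub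
      ((hasDerivAt_id t).mul_const c)
    rwa [one_mul] at this
  have hbound : ∀ t ∈ Icc 0 δ,
      ‖(∫ y : I, g' (y + t * S y) * (S y * h y)) - c‖ ≤ ε / 2 := fun t ht => by
    have htD := hD t ⟨ht.1, ht.2.trans_lt hδr⟩
    have := hC t ht.1 (ht.2.trans hδt.le) (D t) htD.1 htD.2 (fun y => a / 2 * g' y)
      ((hg'c.comp continuous_subtype_val).measurable.const_mul _) fun x => hg'1 x
    simp only [mul_assoc, integral_const_mul, htD.2] at this
    rw [← mul_sub, abs_mul, abs_of_pos (by positivity : 0 < a / 2)] at this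
    rw [Real.norm_eq_abs]
    have e : a / 2 * (ε / 2) = a * (ε / 4) := by ring
    rw [mul_div_assoc, ← e] at this
    exact le_of_mul_le_mul_left this (by positivity)
  have hmv := (convex_Icc 0 δ).norm_image_sub_le_of_norm_hasDerivWithin_le
    (fun t ht => (hF t).hasDerivWithinAt) hbound (left_mem_Icc.2 hδ.1.le) (right_mem_Icc.2 hδ.1.le)
  obtain ⟨hDm, hDx⟩ := hD δ ⟨hδ.1.le, hδr⟩
  have p1 : pairing (noisyTransfer (uniformNoise a) (D δ ∘ T) μ) φ = F δ := by
    rw [pairing_noisyTransfer ha (hDm.comp hT) _ hφb]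
    have := pairing_transfer hT μ (hgbI.comp hDm)
    rw [hμ, pairing_withDensity hh (hgbI.comp hDm)] at this
    simp only [Function.comp_apply]
    rw [← this]
    simp only [F, hDx]
  have p2 : pairing (noisyTransfer (uniformNoise a) T μ) φ = F 0 := by
    rw [pairing_noisyTransfer ha hT _ hφb]
    have := pairing_transfer hT μ hgbI
    rw [hμ, pairing_withDensity hh hgbI] at this
    rw [← this]
    simp only [F, zero_mul, add_zero]
  have p3 : pairing (reflConv (uniformNoise a) ν) φ = c := by
    rw [pairing_reflConv_uniformNoise ha _ hφb]
    have := hν.2 _ (contDiff_noiseAvg a hφ)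
    simp only [(hg' _).deriv] at this
    refine this.trans ?_
    rw [← integral_neg]
    refine integral_congr_ae (Eventually.of_forall fun y => ?_)
    simp only
    ring
  rw [pairing_sub_left _ _ hφb, pairing_smul_left, pairing_sub_left _ _ hφb, p1, p2, p3]
  rw [zero_mul, sub_zero, sub_zero, Real.norm_of_nonneg hδ.1.le, Real.norm_eq_abs] at hmv
  have := (le_abs_self _).trans hmv
  rw [← mul_le_mul_iff_right₀ hδ.1, mul_sub, mul_inv_cancel_left₀ hδ.1.ne']
  linarith

/-! ### The density of the stationary measure -/

theorem boundedVariationOn_of_lipschitz {S : I → ℝ} {K : ℝ≥0} (hS : LipschitzWith K S) :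
    BoundedVariationOn S univ := by
  have h : BoundedVariationOn (fun x : I => (x : ℝ)) univ := by
    have := boundedVariationOn_sub_of_monotone (p := fun x : I => (x : ℝ)) (q := fun _ => 0)
      (Subtype.mono_coe _) monotone_const
    simpa using this
  have h1 := (hS.comp (LipschitzWith.projIcc (zero_le_one (α := ℝ)))).comp_boundedVariationOn h
  have e : (S ∘ projIcc (0 : ℝ) 1 zero_le_one) ∘ (fun x : I => (x : ℝ)) = S := by
    funext x
    simp
  rwa [e] at h1

/-- A stationary measure is a positive measure smoothed by noise, hence of bounded variation; the
transfer operator and multiplication by `S` preserve this. The Radon–Nikodym density agrees almost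
everywhere with the regular one, which is all a weak derivative sees. -/
theorem exists_isWeakDeriv_transfer {a : ℝ} (ha : 0 < a) {T : I → I} (hT : Measurable T)
    (hBV : TransferBoundedBV T) {μ : BS} (hμ : IsStationary (noisyTransfer (uniformNoise a) T) μ)
    {S : I → ℝ} {K : ℝ≥0} (hS : LipschitzWith K S) :
    Integrable ((transfer T μ).rnDeriv volume) (volume : Measure I) ∧
    transfer T μ = (volume : Measure I).withDensityᵥ ((transfer T μ).rnDeriv volume) ∧
    ∃ ν : BS, IsWeakDeriv (fun x => -((transfer T μ).rnDeriv volume x * S x)) ν := by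
  have hpos : 0 ≤ transfer T μ := le_of_pairing_nonneg fun φ h h0 => by
    rw [pairing_transfer hT μ h]
    exact pairing_nonneg hμ.1 fun x => h0 _
  have hfin : bvNorm μ ≠ ⊤ := by
    have := bvNorm_reflConv_ne_top ha hpos
    rwa [show reflConv (uniformNoise a) (transfer T μ) = μ from hμ.2.2] at this
  obtain ⟨C, hC⟩ := hBV
  obtain ⟨h, hi, e, hv⟩ := exists_boundedVariationOn_density
    (ne_top_of_le_ne_top (ENNReal.mul_ne_top ENNReal.coe_ne_top hfin) (hC μ hfin))
  have hae : h =ᵐ[volume] (transfer T μ).rnDeriv volume := by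
    refine SignedMeasure.eq_rnDeriv 0 h hi VectorMeasure.MutuallySingular.zero_left ?_
    rw [zero_add, e]
  have hSv := boundedVariationOn_of_lipschitz hS
  have hSb : IsBddMeas S := isBddMeas_of_continuous hS.continuous
  obtain ⟨M, hM⟩ := hSb.bdd
  have hiS : Integrable (fun x => -(h x * S x)) volume :=
    (hi.mul_bdd hSb.meas.aestronglyMeasurable (Eventually.of_forall hM)).neg
  have hvS : BoundedVariationOn (fun x => -(h x * S x)) univ := LipschitzWith.id.neg.comp_boundedVariationOn (hv.mul hSv)
  obtain ⟨ν, hν⟩ := exists_isWeakDeriv hiS hvS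
  refine ⟨hi.congr hae, e.trans ?_, ν, ?_, fun φ hφ => (hν.2 φ hφ).trans ?_⟩
  · exact WithDensityᵥEq.congr_ae hae
  · exact hν.1.congr (hae.mono fun x hx => by simp only [hx])
  · exact congrArg _ (integral_congr_ae (hae.mono fun x hx => by simp only [hx]))

section

/-! ### Response to a perturbation of the map -/

variable {a : ℝ}

theorem l1Norm_noisyLin_sub_le (ha : 0 < a) {T T' : I → I} (hT : Measurable T)
    (hT' : Measurable T') {δ : ℝ} (h : ∀ x, |(T' x : ℝ) - T x| ≤ δ) (μ : BS) :
    l1Norm (noisyLin ha hT' μ - noisyLin ha hT μ) ≤ 2 / a * δ * l1Norm μ := by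
  refine l1Norm_le fun φ hφ hφ1 => ?_
  have hb : IsBddMeas φ := .of_le hφ hφ1
  rw [pairing_sub_left _ _ hb, coe_noisyLin, coe_noisyLin, pairing_noisyTransfer ha hT' _ hb,
    pairing_noisyTransfer ha hT _ hb,
    ← pairing_sub_right _ ((hb.noiseAvg ha).comp hT') ((hb.noiseAvg ha).comp hT)]
  refine (le_abs_self _).trans (abs_pairing_le_l1Norm _ fun x => ?_)
  refine (abs_noiseAvg_sub_le ha hb hφ1 _ _).trans ?_
  rw [mul_one]
  exact mul_le_mul_of_nonneg_left (h x) (by positivity)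

/-- Linear response for perturbations of the deterministic part of the system. -/
theorem response_map (ha : 0 < a) {T : I → I} (hT : Measurable T) (hBV : TransferBoundedBV T)
    {N : ℕ} {θ : ℝ} (hmix : IsMixing (noisyLin ha hT) N θ) {S : I → ℝ} (hS : LipschitzWith 1 S)
    (h0 : S 0 = 0) {D : ℝ → I → I} {r : ℝ} (hr : 0 < r)
    (hD : ∀ δ ∈ Ico 0 r, Measurable (D δ) ∧ ∀ x : I, (D δ x : ℝ) = x + δ * S x) {f : ℝ → BS}
    (hf : ∀ δ ∈ Ico 0 r, IsStationary (noisyTransfer (uniformNoise a) (D δ ∘ T)) (f δ)) :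
    ∃ ν : BS, IsWeakDeriv (fun x => -((transfer T (f 0)).rnDeriv volume x * S x)) ν ∧
      ∃ w : zeroMassL1, (w : BS) = reflConv (uniformNoise a) ν ∧
        Tendsto (fun δ : ℝ => l1Norm (δ⁻¹ • (f δ - f 0) - (resolventL1 hmix w : BS)))
          (𝓝[>] 0) (𝓝 0) := by
  have hD0 : D 0 = id := funext fun x => Subtype.ext <| by
    rw [(hD 0 ⟨le_rfl, hr⟩).2, zero_mul, add_zero, id]
  have hf0 : IsStationary (noisyTransfer (uniformNoise a) T) (f 0) := by
    have := hf 0 ⟨le_rfl, hr⟩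
    rwa [hD0, Function.id_comp] at this
  obtain ⟨hi, he, ν, hν⟩ := exists_isWeakDeriv_transfer ha hT hBV hf0 hS
  -- Constants are admissible test functions, because `h` is extended by zero beyond the interval.
  have hν0 : ν univ = 0 := by
    have := hν.2 (fun _ => 1) contDiff_const
    simp only [deriv_const, zero_mul, integral_zero, neg_zero] at this
    have h1 : pairing ν (fun _ => 1) = 0 := this
    rwa [pairing_const, one_mul] at h1
  let w : zeroMassL1 := ⟨reflConv (uniformNoise a) ν, reflConv_uniformNoise_mem ha ν,
    (reflConv_uniformNoise_apply_univ ha ν).trans hν0⟩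
  refine ⟨ν, hν, w, rfl, ?_⟩
  classical
  let Lp : ℝ → BS →ₗ[ℝ] BS := fun δ =>
    if h : Measurable (D δ ∘ T) then noisyLin ha h else noisyLin ha hT
  have hLp : ∀ δ ∈ Ico 0 r, ∃ h : Measurable (D δ ∘ T), Lp δ = noisyLin ha h := fun δ hδ =>
    have h := (hD δ hδ).1.comp hT
    ⟨h, dif_pos h⟩
  have hev : ∀ᶠ δ in 𝓝[>] (0 : ℝ), δ ∈ Ico 0 r :=
    mem_of_superset (Ioo_mem_nhdsGT hr) Ioo_subset_Ico_self
  refine tendsto_response hmix (Lp := Lp) (c := 2 / a) (f := f)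
    (Eventually.of_forall fun δ => ?_) (hev.mono fun δ hδ μ => ?_) hf0
    (hev.mono fun δ hδ => ?_) l1Norm_nonneg l1Norm_add_le (fun _ => le_rfl)
    (l1Norm_resolvent_le hmix) ⟨w, w.2.2⟩ ?_
  · by_cases h : Measurable (D δ ∘ T)
    · rw [show Lp δ = noisyLin ha h from dif_pos h]; exact isMarkov_noisyLin ha h
    · rw [show Lp δ = noisyLin ha hT from dif_neg h]; exact isMarkov_noisyLin ha hT
  · obtain ⟨h, e⟩ := hLp δ hδ
    rw [e]
    refine l1Norm_noisyLin_sub_le ha hT h (fun x => ?_) μ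
    rw [Function.comp_apply, (hD δ hδ).2, add_sub_cancel_left, abs_mul, abs_of_nonneg hδ.1]
    exact mul_le_of_le_one_right hδ.1 (abs_le_one_of_lipschitz hS h0 _)
  · obtain ⟨h, e⟩ := hLp δ hδ
    rw [e]
    exact hf δ hδ
  · refine (tendsto_noisyTransfer_perturb ha hT hi he hS h0 hr hD hν).congr' ?_
    filter_upwards [hev] with δ hδ
    obtain ⟨h, e⟩ := hLp δ hδ
    rw [e]
    rfl

/-- The perturbed map need not be eventually onto; mixing is inherited from `T` by stability in
operator norm. -/
theorem eventually_existsUnique_map (ha : 0 < a) {T : I → I} (hT : Measurable T)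
    {N : ℕ} {θ : ℝ} (hmix : IsMixing (noisyLin ha hT) N θ) {S : I → ℝ} (hS : LipschitzWith 1 S)
    (h0 : S 0 = 0) {D : ℝ → I → I} {r : ℝ} (hr : 0 < r)
    (hD : ∀ δ ∈ Ico 0 r, Measurable (D δ) ∧ ∀ x : I, (D δ x : ℝ) = x + δ * S x) :
    ∀ᶠ δ in 𝓝[≥] (0 : ℝ),
      ∃! μ : BS, IsStationary (noisyTransfer (uniformNoise a) (D δ ∘ T)) μ := by
  have hlt : ∀ᶠ δ in 𝓝[≥] (0 : ℝ), θ + N * (2 / a * δ) < 1 := by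
    refine nhdsWithin_le_nhds (ContinuousAt.eventually_lt (by fun_prop) continuousAt_const ?_)
    simpa using hmix.lt_one
  filter_upwards [hlt, Ico_mem_nhdsGE hr] with δ hδ1 hδ
  have h := (hD δ hδ).1.comp hT
  refine (hmix.perturb (isMarkov_noisyLin ha h)
    (l1Norm_noisyLin_sub_le ha hT h fun x => ?_) hδ1).existsUnique_stationary
  rw [Function.comp_apply, (hD δ hδ).2, add_sub_cancel_left, abs_mul, abs_of_nonneg hδ.1]
  exact mul_le_of_le_one_right hδ.1 (abs_le_one_of_lipschitz hS h0 _)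

/-! ### Response to a perturbation of the radius of the noise -/

/-- The derivative of `noiseAvg a φ` with respect to the radius. -/
def noiseAvgDot (a : ℝ) (φ : I → ℝ) (y : ℝ) : ℝ :=
  -(a ^ 2)⁻¹ * (∫ u in (y - a / 2)..(y + a / 2), φ (fold u)) +
    (2 * a)⁻¹ * (φ (fold (y - a / 2)) + φ (fold (y + a / 2)))

theorem pairing_reflConv_uniformNoiseDot (ha : 0 < a) (μ : BS) {φ : I → ℝ} (h : IsBddMeas φ) :
    pairing (reflConv (uniformNoiseDot a) μ) φ = pairing μ fun y : I => noiseAvgDot a φ y := by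
  rw [pairing_reflConv _ _ h]
  congr 1
  funext y
  have hb : IsBddMeas fun t => φ (fold (t + (y : ℝ))) :=
    (h.comp continuous_fold.measurable).comp (by fun_prop)
  rw [uniformNoiseDot, pairing_add_left _ _ hb, pairing_smul_left, pairing_add_left _ _ hb,
    pairing_dirac, pairing_dirac, pairing_indicator_Icc _ _ _ (by linarith) hb,
    intervalIntegral.integral_comp_add_right fun u => φ (fold u), noiseAvgDot]
  simp only [one_mul, neg_add_eq_sub, add_comm (a / 2) (y : ℝ)]

theorem IsBddMeas.noiseAvgDot (a : ℝ) {φ : I → ℝ} (h : IsBddMeas φ) :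
    IsBddMeas fun y : I => noiseAvgDot a φ y := by
  have hf := h.comp continuous_fold.measurable
  have hm : ∀ c : ℝ, IsBddMeas fun y : I => φ (fold ((y : ℝ) + c)) := fun c =>
    hf.comp (by fun_prop)
  have hi : IsBddMeas fun y : I => ∫ u in ((y : ℝ) - a / 2)..(y + a / 2), φ (fold u) := by
    obtain ⟨C, hC⟩ := h.bdd
    refine .of_le (C := C * |a|) (Continuous.measurable ?_) fun y => ?_
    · have e : (fun y : I => ∫ u in ((y : ℝ) - a / 2)..(y + a / 2), φ (fold u)) = fun y : I =>
          (∫ u in (0 : ℝ)..(y + a / 2), φ (fold u)) - ∫ u in (0 : ℝ)..(y - a / 2), φ (fold u) := by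
        funext y
        rw [intervalIntegral.integral_interval_sub_left] <;> exact h.intervalIntegrable_fold _ _
      have hp := intervalIntegral.continuous_primitive (fun s t => h.intervalIntegrable_fold s t) 0
      rw [e]
      exact (hp.comp (by fun_prop)).sub (hp.comp (by fun_prop))
    · simpa using abs_intervalIntegral_fold_le hC ((y : ℝ) - a / 2) (y + a / 2)
  have := (hi.const_mul (-(a ^ 2)⁻¹)).add (((hm (-(a / 2))).add (hm (a / 2))).const_mul (2 * a)⁻¹)
  simpa only [← sub_eq_add_neg, NoisyInterval.noiseAvgDot] using this

/-- The wider window is the old one plus two end strips of width `ξ / 2`. -/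
theorem noiseAvg_add_radius {a ξ : ℝ} {φ : I → ℝ} (h : IsBddMeas φ) (y : ℝ) :
    noiseAvg (a + ξ) φ y = (a + ξ)⁻¹ * ((∫ u in (y - a / 2)..(y + a / 2), φ (fold u)) +
      ((∫ u in (y - a / 2 - ξ / 2)..(y - a / 2), φ (fold u)) +
        ∫ u in (y + a / 2)..(y + a / 2 + ξ / 2), φ (fold u))) := by
  have hi := fun s t => h.intervalIntegrable_fold s t
  rw [noiseAvg, ← intervalIntegral.integral_add_adjacent_intervals (hi _ (y - a / 2)) (hi _ _),
    ← intervalIntegral.integral_add_adjacent_intervals (hi (y - a / 2) (y + a / 2)) (hi _ _),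
    show y - (a + ξ) / 2 = y - a / 2 - ξ / 2 by ring,
    show y + (a + ξ) / 2 = y + a / 2 + ξ / 2 by ring]
  ring

theorem abs_noiseAvg_add_radius_sub_le (ha : 0 < a) {ξ : ℝ} (hξ : 0 ≤ ξ) {φ : I → ℝ}
    (h : IsBddMeas φ) (h1 : ∀ x, |φ x| ≤ 1) (y : ℝ) :
    |noiseAvg (a + ξ) φ y - noiseAvg a φ y| ≤ 2 / a * ξ := by
  rw [noiseAvg_add_radius h, noiseAvg]
  have k0 := abs_intervalIntegral_fold_le h1 (y - a / 2) (y + a / 2)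
  have k1 := abs_intervalIntegral_fold_le h1 (y - a / 2 - ξ / 2) (y - a / 2)
  have k2 := abs_intervalIntegral_fold_le h1 (y + a / 2) (y + a / 2 + ξ / 2)
  set A := ∫ u in (y - a / 2)..(y + a / 2), φ (fold u)
  set E₁ := ∫ u in (y - a / 2 - ξ / 2)..(y - a / 2), φ (fold u)
  set E₂ := ∫ u in (y + a / 2)..(y + a / 2 + ξ / 2), φ (fold u)
  rw [show y + a / 2 - (y - a / 2) = a by ring, one_mul, abs_of_pos ha, abs_le] at k0
  have hξ2 : 0 ≤ ξ / 2 := by positivity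
  rw [sub_sub_cancel, one_mul, abs_of_nonneg hξ2, abs_le] at k1
  rw [add_sub_cancel_left, one_mul, abs_of_nonneg hξ2, abs_le] at k2
  have e : (a + ξ)⁻¹ * (A + (E₁ + E₂)) - a⁻¹ * A = (a * (E₁ + E₂) - ξ * A) / (a * (a + ξ)) := by
    have : a + ξ ≠ 0 := by positivity
    field_simp
    ring
  have e2 : 2 / a * ξ = 2 * ξ / a := by ring
  rw [e, e2, abs_div, abs_of_pos (by positivity : 0 < a * (a + ξ)),
    div_le_div_iff₀ (by positivity) ha]
  have k3 : |a * (E₁ + E₂) - ξ * A| ≤ 2 * ξ * a := by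
    rw [abs_le]
    constructor <;> nlinarith
  nlinarith [mul_le_mul_of_nonneg_right k3 ha.le, mul_nonneg (mul_nonneg hξ hξ) ha.le]

theorem abs_integral_sub_le_of_lipschitz {u : ℝ → ℝ} (hu : LipschitzWith 1 u) {s t c : ℝ} {ξ : ℝ}
    (hst : t = s + ξ / 2) (hξ : 0 ≤ ξ) (hc : c = s ∨ c = t) :
    |(∫ x in s..t, u x) - ξ / 2 * u c| ≤ ξ ^ 2 / 4 := by
  have e : (∫ x in s..t, u x) - ξ / 2 * u c = ∫ x in s..t, (u x - u c) := by
    rw [intervalIntegral.integral_sub (hu.continuous.intervalIntegrable _ _)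
      intervalIntegrable_const, intervalIntegral.integral_const, hst, smul_eq_mul]
    ring
  rw [e]
  refine (intervalIntegral.norm_integral_le_of_norm_le_const (C := ξ / 2)
    (f := fun x => u x - u c) fun x hx => ?_).trans ?_
  · rw [uIoc_of_le (by linarith)] at hx
    have := hu.dist_le_mul x c
    rw [NNReal.coe_one, one_mul, Real.dist_eq, Real.dist_eq] at this
    refine this.trans ?_
    rw [abs_le]
    rcases hc with rfl | rfl <;> constructor <;> linarith [hx.1, hx.2]
  · rw [hst, add_sub_cancel_left, abs_of_nonneg (by positivity)]
    exact (by ring : ξ / 2 * (ξ / 2) = ξ ^ 2 / 4).le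

/-- On each end strip a Lipschitz function is within `ξ / 2` of its endpoint value, so the strips
yield the atoms of `uniformNoiseDot`. For merely bounded test functions this approximation is lost,
whence the Wasserstein norm. -/
theorem abs_noiseAvg_slope_sub_le (ha : 0 < a) {ξ : ℝ} (hξ : 0 < ξ) {g : I → ℝ}
    (hg : LipschitzWith 1 g) (h1 : ∀ x, |g x| ≤ 1) (y : ℝ) :
    |ξ⁻¹ * (noiseAvg (a + ξ) g y - noiseAvg a g y) - noiseAvgDot a g y| ≤
      (2 / a ^ 2 + 1 / (2 * a)) * ξ := by
  have hb : IsBddMeas g := isBddMeas_of_continuous hg.continuous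
  have hu : LipschitzWith 1 fun u => g (fold u) := by
    simpa only [mul_one] using! hg.comp lipschitzWith_fold
  rw [noiseAvg_add_radius hb, noiseAvg, noiseAvgDot]
  have k0 := abs_intervalIntegral_fold_le h1 (y - a / 2) (y + a / 2)
  have k1 := abs_integral_sub_le_of_lipschitz hu (sub_add_cancel (y - a / 2) (ξ / 2)).symm hξ.le
    (Or.inr rfl)
  have k2 := abs_integral_sub_le_of_lipschitz hu (rfl : y + a / 2 + ξ / 2 = _) hξ.le
    (Or.inl rfl)
  have k3 := h1 (fold (y - a / 2))
  have k4 := h1 (fold (y + a / 2))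
  set A := ∫ u in (y - a / 2)..(y + a / 2), g (fold u)
  set E₁ := ∫ u in (y - a / 2 - ξ / 2)..(y - a / 2), g (fold u)
  set E₂ := ∫ u in (y + a / 2)..(y + a / 2 + ξ / 2), g (fold u)
  set u₁ := g (fold (y - a / 2))
  set u₂ := g (fold (y + a / 2))
  rw [show y + a / 2 - (y - a / 2) = a by ring, one_mul, abs_of_pos ha] at k0
  have hb0 : 0 < a + ξ := by positivity
  -- Each summand is of order `ξ`: the first and last come from replacing `a + ξ` by `a`, the middle
  -- two from the strips.
  have e : ξ⁻¹ * ((a + ξ)⁻¹ * (A + (E₁ + E₂)) - a⁻¹ * A) -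
      (-(a ^ 2)⁻¹ * A + (2 * a)⁻¹ * (u₁ + u₂)) = A * (ξ / (a ^ 2 * (a + ξ))) +
        (E₁ - ξ / 2 * u₁) * (1 / (ξ * (a + ξ))) + (E₂ - ξ / 2 * u₂) * (1 / (ξ * (a + ξ))) -
        (u₁ + u₂) * (ξ / (2 * a * (a + ξ))) := by
    field_simp
    ring
  have hinv : (a + ξ)⁻¹ ≤ a⁻¹ := inv_anti₀ ha (by linarith)
  have b1 : |A * (ξ / (a ^ 2 * (a + ξ)))| ≤ ξ / a ^ 2 := by
    rw [abs_mul, abs_of_pos (by positivity : 0 < ξ / (a ^ 2 * (a + ξ)))]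
    calc |A| * (ξ / (a ^ 2 * (a + ξ))) ≤ a * (ξ / (a ^ 2 * (a + ξ))) := by gcongr
      _ = ξ / a * (a + ξ)⁻¹ := by field_simp
      _ ≤ ξ / a * a⁻¹ := by gcongr
      _ = ξ / a ^ 2 := by field_simp
  have b2 : ∀ E : ℝ, |E| ≤ ξ ^ 2 / 4 → |E * (1 / (ξ * (a + ξ)))| ≤ ξ / (4 * a) := fun E hE => by
    rw [abs_mul, abs_of_pos (by positivity : 0 < 1 / (ξ * (a + ξ)))]
    calc |E| * (1 / (ξ * (a + ξ))) ≤ ξ ^ 2 / 4 * (1 / (ξ * (a + ξ))) := by gcongr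
      _ = ξ / 4 * (a + ξ)⁻¹ := by field_simp
      _ ≤ ξ / 4 * a⁻¹ := by gcongr
      _ = ξ / (4 * a) := by field_simp
  have b3 : |(u₁ + u₂) * (ξ / (2 * a * (a + ξ)))| ≤ ξ / a ^ 2 := by
    rw [abs_mul, abs_of_pos (by positivity : 0 < ξ / (2 * a * (a + ξ)))]
    have : |u₁ + u₂| ≤ 2 := (abs_add_le _ _).trans (by linarith)
    calc |u₁ + u₂| * (ξ / (2 * a * (a + ξ))) ≤ 2 * (ξ / (2 * a * (a + ξ))) := by gcongr
      _ = ξ / a * (a + ξ)⁻¹ := by field_simp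
      _ ≤ ξ / a * a⁻¹ := by gcongr
      _ = ξ / a ^ 2 := by field_simp
  have e3 : (2 / a ^ 2 + 1 / (2 * a)) * ξ = ξ / a ^ 2 + ξ / (4 * a) + ξ / (4 * a) + ξ / a ^ 2 := by
    field_simp
    ring
  rw [e, e3]
  exact (abs_sub _ _).trans (add_le_add ((abs_add_le _ _).trans (add_le_add
    ((abs_add_le _ _).trans (add_le_add b1 (b2 _ k1))) (b2 _ k2))) b3)

/-- The dual operator sends functions bounded by one to Lipschitz functions bounded by one, since
`T` is Lipschitz. The maximum with `1` lets one constant serve both bounds. -/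
theorem l1Norm_noisyLin_le_wNorm (ha : 0 < a) {T : I → I} (hT : Measurable T) {K : ℝ≥0}
    (hK : LipschitzWith K T) :
    ∃ C : ℝ, 0 ≤ C ∧ ∀ v, l1Norm (noisyLin ha hT v) ≤ C * wNorm v := by
  let C : ℝ≥0 := max 1 (Real.toNNReal (2 / a) * K)
  have hC1 : (1 : ℝ) ≤ C := by exact_mod_cast le_max_left _ _
  refine ⟨C, C.2, fun v => l1Norm_le fun φ hφ hφ1 => ?_⟩
  have hb : IsBddMeas φ := .of_le hφ hφ1
  rw [coe_noisyLin, pairing_noisyTransfer ha hT _ hb]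
  refine pairing_le_mul_wNorm v (zero_lt_one.trans_le (le_max_left _ _)) ?_
    fun x => (abs_noiseAvg_le ha hφ1 _).trans hC1
  have h1 : LipschitzWith (Real.toNNReal (2 / a)) (noiseAvg a φ) :=
    LipschitzWith.of_dist_le_mul fun y z => by
      have := abs_noiseAvg_sub_le ha hb hφ1 y z
      rwa [mul_one, ← Real.coe_toNNReal (2 / a) (by positivity)] at this
  have h2 : LipschitzWith K fun x => (T x : ℝ) := by
    simpa only [one_mul] using! LipschitzWith.subtype_val _ |>.comp hK
  exact (h1.comp h2).weaken (le_max_right _ _)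

theorem wNorm_resolvent_le (ha : 0 < a) {T : I → I} (hT : Measurable T) {K : ℝ≥0}
    (hK : LipschitzWith K T) {N : ℕ} {θ : ℝ} (hmix : IsMixing (noisyLin ha hT) N θ) :
    ∃ C : ℝ, ∀ v : zeroMass, wNorm (resolvent hmix v) ≤ C * wNorm (v : BS) := by
  obtain ⟨C, hC0, hC⟩ := l1Norm_noisyLin_le_wNorm ha hT hK
  refine ⟨1 + N / (1 - θ) * C, fun v => ?_⟩
  have hR0 : 0 ≤ (N : ℝ) / (1 - θ) := div_nonneg (Nat.cast_nonneg N) (by linarith [hmix.lt_one])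
  obtain ⟨x, hx⟩ : ∃ x : zeroMass, (x : BS) = noisyLin ha hT v :=
    ⟨⟨_, (hmix.mass v).trans v.2⟩, rfl⟩
  have hd : (v : BS) - noisyLin ha hT v ∈ zeroMass := sub_mem_zeroMass (hmix.mass v).symm
  obtain ⟨z, hz⟩ : ∃ z : zeroMass, z = ⟨(v : BS) - noisyLin ha hT v, hd⟩ := ⟨_, rfl⟩
  have hv : v = z + x := Subtype.ext <| by
    rw [Submodule.coe_add, hx, hz, sub_add_cancel]
  -- Splitting off the zeroth term leaves `R (L v)`, where total variation estimates apply.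
  have e : (resolvent hmix v : BS) = v + resolvent hmix x := by
    have h1 : resolvent hmix v = resolvent hmix z + resolvent hmix x := by rw [← map_add, ← hv]
    rw [h1, Submodule.coe_add, hz, resolvent_sub_map hmix v.2 hd]
  have h1 := wNorm_add_le v (resolvent hmix x)
  have h2 := wNorm_le_l1Norm (resolvent hmix x)
  have h3 := l1Norm_resolvent_le hmix x
  have h4 := mul_le_mul_of_nonneg_left (hC v) hR0
  rw [hx] at h3
  rw [e]
  linarith

theorem isResolvent_resolvent_wNorm (ha : 0 < a) {T : I → I} (hT : Measurable T) {K : ℝ≥0}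
    (hK : LipschitzWith K T) {N : ℕ} {θ : ℝ} (hmix : IsMixing (noisyLin ha hT) N θ) :
    IsResolvent wNorm zeroMass 1 (noisyTransfer (uniformNoise a) T) (resolvent hmix) where
  tendsto v := by
    refine squeeze_zero (fun _ => wNorm_nonneg _) (fun _ => wNorm_le_l1Norm _) ?_
    simpa [coe_noisyLin] using tendsto_resolvent hmix v
  bounded := wNorm_resolvent_le ha hT hK hmix

/-- Linear response for perturbations of the radius of the noise. -/
theorem response_radius (ha : 0 < a) {T : I → I} (hT : Measurable T) {K : ℝ≥0}
    (hK : LipschitzWith K T) {N : ℕ} {θ : ℝ} (hmix : IsMixing (noisyLin ha hT) N θ)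
    {r : ℝ} (hr : 0 < r) {f : ℝ → BS}
    (hf : ∀ ξ ∈ Ico 0 r, IsStationary (noisyTransfer (uniformNoise (a + ξ)) T) (f ξ)) :
    ∃ w : zeroMass, (w : BS) = reflConv (uniformNoiseDot a) (transfer T (f 0)) ∧
      Tendsto (fun ξ : ℝ => wNorm (ξ⁻¹ • (f ξ - f 0) - (resolvent hmix w : BS)))
        (𝓝[>] 0) (𝓝 0) := by
  have hf0 : IsStationary (noisyTransfer (uniformNoise a) T) (f 0) := by
    have := hf 0 ⟨le_rfl, hr⟩
    rwa [add_zero] at this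
  have hw : reflConv (uniformNoiseDot a) (transfer T (f 0)) ∈ zeroMass := by
    have h := pairing_reflConv_uniformNoiseDot ha (transfer T (f 0)) (.const (1 : ℝ))
    -- The interior loses mass `a⁻¹` and the two atoms restore it.
    have e : ∀ y : I, noiseAvgDot a (fun _ => 1) y = 0 := fun y => by
      rw [noiseAvgDot, intervalIntegral.integral_const, smul_eq_mul]
      field_simp
      ring
    simp only [e, pairing_const, one_mul, zero_mul] at h
    exact h
  refine ⟨⟨_, hw⟩, rfl, ?_⟩
  obtain ⟨C, hC⟩ := wNorm_resolvent_le ha hT hK hmix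
  let Lp : ℝ → BS →ₗ[ℝ] BS := fun ξ =>
    if h : 0 < a + ξ then noisyLin h hT else noisyLin ha hT
  have hLp : ∀ ξ, 0 ≤ ξ → ∃ h : 0 < a + ξ, Lp ξ = noisyLin h hT := fun ξ hξ =>
    have h : 0 < a + ξ := by positivity
    ⟨h, dif_pos h⟩
  have hev : ∀ᶠ ξ in 𝓝[>] (0 : ℝ), ξ ∈ Ioo 0 r := Ioo_mem_nhdsGT hr
  refine tendsto_response hmix (Lp := Lp) (c := 2 / a) (f := f)
    (hev.mono fun ξ hξ => ?_) (hev.mono fun ξ hξ μ => ?_) hf0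
    (hev.mono fun ξ hξ => ?_) wNorm_nonneg wNorm_add_le wNorm_le_l1Norm hC ⟨_, hw⟩ ?_
  · obtain ⟨h, e⟩ := hLp ξ hξ.1.le
    rw [e]
    exact isMarkov_noisyLin h hT
  · obtain ⟨h, e⟩ := hLp ξ hξ.1.le
    rw [e]
    refine l1Norm_le fun φ hφ hφ1 => ?_
    have hb : IsBddMeas φ := .of_le hφ hφ1
    rw [pairing_sub_left _ _ hb, coe_noisyLin, coe_noisyLin, pairing_noisyTransfer h hT _ hb,
      pairing_noisyTransfer ha hT _ hb,
      ← pairing_sub_right _ ((hb.noiseAvg h).comp hT) ((hb.noiseAvg ha).comp hT)]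
    exact (le_abs_self _).trans (abs_pairing_le_l1Norm _ fun x =>
      abs_noiseAvg_add_radius_sub_le ha hξ.1.le hb hφ1 _)
  · obtain ⟨h, e⟩ := hLp ξ hξ.1.le
    rw [e]
    exact hf ξ ⟨hξ.1.le, hξ.2⟩
  · have hlim : Tendsto (fun ξ : ℝ => (2 / a ^ 2 + 1 / (2 * a)) * ξ * l1Norm (f 0))
        (𝓝[>] 0) (𝓝 0) := by
      refine Tendsto.mono_left ?_ nhdsWithin_le_nhds
      have : Continuous fun ξ : ℝ => (2 / a ^ 2 + 1 / (2 * a)) * ξ * l1Norm (f 0) := by fun_prop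
      simpa using this.tendsto 0
    refine squeeze_zero' (Eventually.of_forall fun _ => wNorm_nonneg _)
      (hev.mono fun ξ hξ => ?_) hlim
    obtain ⟨h, e⟩ := hLp ξ hξ.1.le
    rw [e]
    refine wNorm_le fun g hg hg1 => ?_
    have hb : IsBddMeas g := isBddMeas_of_continuous hg.continuous
    have i1 := (hb.noiseAvg h).comp hT
    have i2 := (hb.noiseAvg ha).comp hT
    have i3 := (hb.noiseAvgDot a).comp hT
    rw [pairing_sub_left _ _ hb, pairing_smul_left, pairing_sub_left _ _ hb, coe_noisyLin,
      coe_noisyLin, pairing_noisyTransfer h hT _ hb, pairing_noisyTransfer ha hT _ hb,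
      pairing_reflConv_uniformNoiseDot ha _ hb, pairing_transfer hT _ (hb.noiseAvgDot a),
      ← pairing_sub_right _ i1 i2, ← pairing_const_mul_right,
      ← pairing_sub_right _ ((i1.sub i2).const_mul _) i3]
    exact (le_abs_self _).trans (abs_pairing_le_l1Norm _ fun x =>
      abs_noiseAvg_slope_sub_le ha hξ.1 hg hg1 _)

end

end NoisyInterval

end

/-! ### The main theorem -/

open NoisyInterval in
theorem mainTheorem5
    (T : I → I) (hT_sing : Measure.QuasiMeasurePreserving T volume volume)
    (hT_C2 : IsPiecewiseC2 T) (hT_BV : TransferBoundedBV T) (hT_onto : EventuallyOnto T)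
    (a : ℝ) (ha : 0 < a) :
    -- perturbing the map
    (∀ (S : I → ℝ) (D : ℝ → I → I) (δmax : ℝ), 0 < δmax →
      LipschitzWith 1 S → S 0 = 0 → S 1 = 0 → IsFiniteUnionOfIntervals (tsupport S) →
      (∀ δ ∈ Ico 0 δmax, Continuous (D δ) ∧ Function.Bijective (D δ) ∧
        ∀ x : I, (D δ x : ℝ) = x + δ * S x) →
      (∀ᶠ δ in 𝓝[≥] (0 : ℝ),
        ∃! μ : BS, IsStationary (noisyTransfer (uniformNoise a) (D δ ∘ T)) μ) ∧
      ∃ R : zeroMassL1 →ₗ[ℝ] zeroMassL1,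
        IsResolvent l1Norm zeroMassL1 1 (noisyTransfer (uniformNoise a) T) R ∧
        ∀ f : ℝ → BS,
          (∀ δ ∈ Ico 0 δmax,
            IsStationary (noisyTransfer (uniformNoise a) (D δ ∘ T)) (f δ)) →
          ∃ ν : BS,
            IsWeakDeriv (fun x => -((transfer T (f 0)).rnDeriv volume x * S x)) ν ∧
            ∃ w : zeroMassL1, (w : BS) = reflConv (uniformNoise a) ν ∧
              Tendsto (fun δ : ℝ => l1Norm (δ⁻¹ • (f δ - f 0) - (R w : BS)))
                (𝓝[>] 0) (𝓝 0)) ∧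
    -- perturbing the radius of the noise
    ((∃ K : ℝ≥0, LipschitzWith K T) →
      (∀ᶠ ξ in 𝓝[≥] (0 : ℝ),
        ∃! μ : BS, IsStationary (noisyTransfer (uniformNoise (a + ξ)) T) μ) ∧
      ∃ R : zeroMass →ₗ[ℝ] zeroMass,
        IsResolvent wNorm zeroMass 1 (noisyTransfer (uniformNoise a) T) R ∧
        ∀ (ξmax : ℝ), 0 < ξmax → ∀ f : ℝ → BS,
          (∀ ξ ∈ Ico 0 ξmax,
            IsStationary (noisyTransfer (uniformNoise (a + ξ)) T) (f ξ)) →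
          ∃ w : zeroMass, (w : BS) = reflConv (uniformNoiseDot a) (transfer T (f 0)) ∧
            Tendsto (fun ξ : ℝ => wNorm (ξ⁻¹ • (f ξ - f 0) - (R w : BS)))
              (𝓝[>] 0) (𝓝 0)) := by
  obtain ⟨N, θ, hmix⟩ := exists_isMixing ha hT_sing.measurable hT_C2 hT_onto
  refine ⟨fun S D r hr hS h0 _ _ hD => ?_, fun ⟨K, hK⟩ => ⟨?_, resolvent hmix,
    isResolvent_resolvent_wNorm ha hT_sing.measurable hK hmix, fun r hr f hf =>
      response_radius ha hT_sing.measurable hK hmix hr hf⟩⟩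
  · have hD' : ∀ δ ∈ Ico 0 r, Measurable (D δ) ∧ ∀ x : I, (D δ x : ℝ) = x + δ * S x :=
      fun δ hδ => ⟨(hD δ hδ).1.measurable, (hD δ hδ).2.2⟩
    exact ⟨eventually_existsUnique_map ha hT_sing.measurable hmix hS h0 hr hD', resolventL1 hmix,
      isResolvent_resolventL1 hmix, fun f hf =>
        response_map ha hT_sing.measurable hT_BV hmix hS h0 hr hD' hf⟩
  -- Here the map is unchanged, so mixing holds directly for every radius `a + ξ` and no
  -- perturbation argument is needed.
  · filter_upwards [self_mem_nhdsWithin] with ξ hξ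
    have hξ' : 0 < a + ξ := add_pos_of_pos_of_nonneg ha hξ
    obtain ⟨N', θ', hmix'⟩ := exists_isMixing hξ' hT_sing.measurable hT_C2 hT_onto
    exact hmix'.existsUnique_stationary
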